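/- A hyperbolic space is a geodesic metric space $S$ that is Gromov $\delta$-hyperbolic for some $\delta$, i.e. $\langle x|y\rangle_o \ge \min\{\langle x|z\rangle_o,\langle z|y\rangle_o\}-\delta$ for all $x,y,z,o\in S$, where $\langle x|y\rangle_o=\tfrac12(d(x,o)+d(y,o)-d(x,y))$. Its Gromov boundary $\partial S$ is the set of classes of sequences $(x_i)$ with $\langle x_i|x_j\rangle_o\to\infty$, two sequences being equivalent when $\langle x_i|y_j\rangle_o\to\infty$ as $i,j\to\infty$; $S\cup\partial S$ carries its usual topology and $\partial S$ the subspace topology. All actions on $S$ are by isometries. For an action of a group $G$ on $S$, the limit set $\Lambda_S(G)\subseteq\partial S$ is the set of boundary points in the closure of an orbit $Gs$ in $S\cup\partial S$ (independent of $s$), and the elliptic radical $E_S(G)$ is the subgroup of all $g\in G$ that fix every point of $\Lambda_S(G)$. An element $g$ is loxodromic if $\langle g\rangle$ has unbounded orbits and $g$ fixes exactly two points of $\partial S$. The action is of general type if its orbits are unbounded and $G$ contains two loxodromic elements whose sets of fixed points on $\partial S$ are disjoint. An action of $G$ by homeomorphisms on a topological space is topologically free if the set of fixed points of every non-trivial element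 of $G$ has empty interior. A group $G$ is faithful weakly hyperbolic if it admits a general type action on a hyperbolic space $S$ such that the induced action on $\Lambda_S(G)$ is faithful; it is lim-free if it admits a general type action on a hyperbolic space $S$ such that the induced action on $\Lambda_S(G)$ is topologically free. It is mixed identity free (MIF) if for every $n$ and every non-trivial $w\in G*F_n$, where $F_n$ is the free group of rank $n$, there is a homomorphism $G*F_n\to G$ that is the identity on $G$ and does not send $w$ to $1$. Theorem. For any faithful weakly hyperbolic group $G$, the following conditions are equivalent: (a) $G$ is lim-free; (b) for any general type action of $G$ on a hyperbolic space $S$ with trivial elliptic radical $E_S(G)$, the induced action on $\Lambda_S(G)$ is topologically free; (c) $G$ is MIF. -/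

import Mathlib

open Filter Topology

universe u v

namespace HypGroup

section Space

variable {S : Type v} [MetricSpace S]

/-- The Gromov product of `x` and `y` with respect to the base point `o`. -/
noncomputable def gromovProduct (o x y : S) : ℝ :=
  (dist x o + dist y o - dist x y) / 2

/-- Any two points are joined by an isometrically embedded compact interval. -/
def IsGeodesicSpace (S : Type v) [MetricSpace S] : Prop :=
  ∀ x y : S, ∃ γ : ℝ → S, γ 0 = x ∧ γ (dist x y) = y ∧
    ∀ s ∈ Set.Icc 0 (dist x y), ∀ t ∈ Set.Icc 0 (dist x y), dist (γ s) (γ t) = |s - t|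

/-- The four-point condition for some `δ`. -/
def IsGromovHyperbolic (S : Type v) [MetricSpace S] : Prop :=
  ∃ δ : ℝ, ∀ x y z o : S,
    min (gromovProduct o x z) (gromovProduct o z y) - δ ≤ gromovProduct o x y

/-- A hyperbolic space is a geodesic Gromov hyperbolic metric space. -/
class HyperbolicSpace (S : Type v) [MetricSpace S] : Prop where
  geodesic : IsGeodesicSpace S
  hyperbolic : IsGromovHyperbolic S

/-- The Gromov products `⟨x i | y j⟩` tend to infinity as `i, j → ∞`
(for every base point, equivalently for some base point). -/
def ProductTendsto (x y : ℕ → S) : Prop :=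
  ∀ o : S, Tendsto (fun p : ℕ × ℕ => gromovProduct o (x p.1) (y p.2)) atTop atTop

variable (S) in
/-- Sequences that converge at infinity. -/
def SeqAtInfinity : Type v := {x : ℕ → S // ProductTendsto x x}

theorem gromovProduct_comm (o x y : S) : gromovProduct o x y = gromovProduct o y x := by
  unfold gromovProduct
  rw [dist_comm x y]
  ring

theorem ProductTendsto.symm {x y : ℕ → S} (h : ProductTendsto x y) : ProductTendsto y x := by
  intro o
  have hs : Tendsto (Prod.swap : ℕ × ℕ → ℕ × ℕ) atTop atTop := by
    rw [← prod_atTop_atTop_eq]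
    exact tendsto_snd.prodMk tendsto_fst
  refine ((h o).comp hs).congr fun p => ?_
  exact gromovProduct_comm _ _ _

theorem ProductTendsto.trans [HyperbolicSpace S] {x y z : ℕ → S} (h : ProductTendsto x y)
    (h' : ProductTendsto y z) : ProductTendsto x z := by
  intro o
  obtain ⟨δ, hδ⟩ := HyperbolicSpace.hyperbolic (S := S)
  have hd : Tendsto (fun p : ℕ × ℕ => (p.1, p.1)) atTop atTop := by
    rw [← prod_atTop_atTop_eq]
    exact tendsto_fst.prodMk tendsto_fst
  rw [tendsto_atTop]
  intro b
  filter_upwards [tendsto_atTop.1 ((h o).comp hd) (b + δ), tendsto_atTop.1 (h' o) (b + δ)]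
    with p h1 h2
  have h3 := hδ (x p.1) (z p.2) (y p.1) o
  have h4 := le_min h1 h2
  simp only [Function.comp_apply] at h4
  linarith

/-- Equivalence of sequences converging at infinity. -/
instance seqSetoid [HyperbolicSpace S] : Setoid (SeqAtInfinity S) where
  r x y := ProductTendsto x.1 y.1
  iseqv := ⟨fun x => x.2, fun h => h.symm, fun h h' => h.trans h'⟩

variable (S) in
/-- The Gromov boundary `∂S`. -/
def GromovBoundary [HyperbolicSpace S] : Type v := Quotient (seqSetoid (S := S))

variable (S) in
/-- The bordification `S ∪ ∂S` of a hyperbolic space. -/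
inductive Bordification [HyperbolicSpace S] : Type v
  | point (x : S)
  | bdry (a : GromovBoundary S)

variable [HyperbolicSpace S]

/-- The sequence `x` converges to the boundary point `a`. -/
def ConvergesTo (x : SeqAtInfinity S) (a : GromovBoundary S) : Prop :=
  Quotient.mk seqSetoid x = a

/-- The Gromov product of a boundary point with a point of the bordification, with values in
the extended reals. -/
noncomputable def extGromovProduct (o : S) (a : GromovBoundary S) : Bordification S → EReal
  | .point y => ⨅ x : {x : SeqAtInfinity S // ConvergesTo x a},
      liminf (fun i : ℕ => ((gromovProduct o (x.1.1 i) y : ℝ) : EReal)) atTop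
  | .bdry b => ⨅ (x : {x : SeqAtInfinity S // ConvergesTo x a})
      (y : {y : SeqAtInfinity S // ConvergesTo y b}),
      liminf (fun p : ℕ × ℕ => ((gromovProduct o (x.1.1 p.1) (y.1.1 p.2) : ℝ) : EReal)) atTop

/-- The basic neighbourhood `U_o(a, r)` of the boundary point `a`. -/
def basicNhd (o : S) (a : GromovBoundary S) (r : ℝ) : Set (Bordification S) :=
  {z | (r : EReal) < extGromovProduct o a z}

theorem basicNhd_anti (o : S) (a : GromovBoundary S) {r r' : ℝ} (h : r ≤ r') :
    basicNhd o a r' ⊆ basicNhd o a r := fun _ hz =>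
  lt_of_le_of_lt (EReal.coe_le_coe_iff.2 h) hz

/-- The topology of `S ∪ ∂S`: a set is open if its trace on `S` is open for the metric and it
contains a set `U_o(a, r)` for each of its boundary points `a`. -/
instance bordificationTopology : TopologicalSpace (Bordification S) where
  IsOpen U := IsOpen {x : S | Bordification.point x ∈ U} ∧
    ∀ a : GromovBoundary S, Bordification.bdry a ∈ U → ∀ o : S, ∃ r : ℝ, basicNhd o a r ⊆ U
  isOpen_univ := ⟨by simp, fun _ _ _ => ⟨0, Set.subset_univ _⟩⟩
  isOpen_inter := by
    rintro U V ⟨hU, hU'⟩ ⟨hV, hV'⟩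
    refine ⟨hU.inter hV, fun a ha o => ?_⟩
    obtain ⟨r, hr⟩ := hU' a ha.1 o
    obtain ⟨r', hr'⟩ := hV' a ha.2 o
    exact ⟨max r r', Set.subset_inter ((basicNhd_anti o a (le_max_left _ _)).trans hr)
      ((basicNhd_anti o a (le_max_right _ _)).trans hr')⟩
  isOpen_sUnion := by
    intro 𝒰 h
    constructor
    · have : {x : S | Bordification.point x ∈ ⋃₀ 𝒰} =
          ⋃ U ∈ 𝒰, {x : S | Bordification.point x ∈ U} := by
        ext x
        simp
      rw [this]
      exact isOpen_biUnion fun U hU => (h U hU).1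
    · rintro a ⟨U, hU, ha⟩ o
      obtain ⟨r, hr⟩ := (h U hU).2 a ha o
      exact ⟨r, hr.trans (Set.subset_sUnion_of_mem hU)⟩

/-- The subspace topology of `∂S` in `S ∪ ∂S`. -/
instance boundaryTopology : TopologicalSpace (GromovBoundary S) :=
  TopologicalSpace.induced Bordification.bdry bordificationTopology

end Space

section Action

variable {G : Type u} [Group G] {S : Type v} [MetricSpace S] [MulAction G S]
  [IsIsometricSMul G S]

theorem gromovProduct_smul (g : G) (o x y : S) :
    gromovProduct (g • o) (g • x) (g • y) = gromovProduct o x y := by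
  simp [gromovProduct]

theorem ProductTendsto.smul (g : G) {x y : ℕ → S} (h : ProductTendsto x y) :
    ProductTendsto (fun i => g • x i) (fun i => g • y i) := by
  intro o
  refine (h (g⁻¹ • o)).congr fun p => ?_
  rw [← gromovProduct_smul g, smul_inv_smul]

/-- The action on sequences converging at infinity. -/
def SeqAtInfinity.smul (g : G) (x : SeqAtInfinity S) : SeqAtInfinity S :=
  ⟨fun i => g • x.1 i, x.2.smul g⟩

variable [HyperbolicSpace S]

/-- The induced action on the Gromov boundary. -/
instance boundaryAction : MulAction G (GromovBoundary S) where
  smul g := Quotient.map (SeqAtInfinity.smul g) fun _ _ h => ProductTendsto.smul g h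
  one_smul a := by
    induction a using Quotient.inductionOn with
    | h x => exact congrArg (Quotient.mk _) (Subtype.ext (funext fun i => one_smul G (x.1 i)))
  mul_smul g h a := by
    induction a using Quotient.inductionOn with
    | h x => exact congrArg (Quotient.mk _) (Subtype.ext (funext fun i => mul_smul g h (x.1 i)))

theorem ConvergesTo.smul (g : G) {x : SeqAtInfinity S} {a : GromovBoundary S}
    (h : ConvergesTo x a) : ConvergesTo (x.smul g) (g • a) := by
  subst h
  rfl

/-- The induced action on the bordification. -/
instance bordificationAction : MulAction G (Bordification S) where
  smul g z := match z with
    | .point x => .point (g • x)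
    | .bdry a => .bdry (g • a)
  one_smul z := by
    cases z with
    | point x => exact congrArg Bordification.point (one_smul G x)
    | bdry a => exact congrArg Bordification.bdry (one_smul G a)
  mul_smul g h z := by
    cases z with
    | point x => exact congrArg Bordification.point (mul_smul g h x)
    | bdry a => exact congrArg Bordification.bdry (mul_smul g h a)

theorem smul_point (g : G) (x : S) :
    g • (Bordification.point x) = Bordification.point (g • x) := rfl

theorem smul_bdry (g : G) (a : GromovBoundary S) :
    g • (Bordification.bdry a) = Bordification.bdry (g • a) := rfl

theorem extGromovProduct_le_smul (g : G) (o : S) (a : GromovBoundary S) (z : Bordification S) :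
    extGromovProduct o a z ≤ extGromovProduct (g • o) (g • a) (g • z) := by
  have key : ∀ {b : GromovBoundary S} {y : SeqAtInfinity S}, ConvergesTo y (g • b) →
      ConvergesTo (y.smul g⁻¹) b := fun {b y} hy => by simpa using hy.smul g⁻¹
  have hp : ∀ x y : S, gromovProduct o (g⁻¹ • x) y = gromovProduct (g • o) x (g • y) :=
    fun x y => by rw [← gromovProduct_smul g, smul_inv_smul]
  cases z with
  | point y =>
    refine le_iInf fun x => (iInf_le _ ⟨x.1.smul g⁻¹, key x.2⟩).trans (le_of_eq ?_)
    simp only [SeqAtInfinity.smul, hp]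
  | bdry b =>
    refine le_iInf fun x => le_iInf fun y =>
      (iInf₂_le (⟨x.1.smul g⁻¹, key x.2⟩ : {x : SeqAtInfinity S // ConvergesTo x a})
        (⟨y.1.smul g⁻¹, key y.2⟩ : {y : SeqAtInfinity S // ConvergesTo y b})).trans
        (le_of_eq ?_)
    simp only [SeqAtInfinity.smul, hp, smul_inv_smul]

theorem continuous_smul_bordification (g : G) :
    Continuous fun z : Bordification S => g • z := by
  refine ⟨fun U hU => ⟨hU.1.preimage (continuous_const_smul g), fun a ha o => ?_⟩⟩
  obtain ⟨r, hr⟩ := hU.2 (g • a) ha (g • o)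
  exact ⟨r, fun z hz => hr (lt_of_lt_of_le hz (extGromovProduct_le_smul g o a z))⟩

variable (G S) in
/-- The limit set `Λ_S(G)`: the boundary points in the closure in `S ∪ ∂S` of an orbit `Gs`
(the choice of `s` is immaterial). It is recorded with the induced action of `G`. -/
def limitSet : SubMulAction G (GromovBoundary S) where
  carrier := {a | ∃ s : S, Bordification.bdry a ∈
    closure (Set.range fun g : G => Bordification.point (g • s))}
  smul_mem' := by
    rintro g a ⟨s, hs⟩
    refine ⟨s, ?_⟩
    rw [← smul_bdry]
    refine map_mem_closure (continuous_smul_bordification g) hs ?_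
    rintro _ ⟨h, rfl⟩
    exact ⟨g * h, by simp only [smul_point, mul_smul]⟩

variable (S) in
/-- `g` is loxodromic: the cyclic group it generates has unbounded orbits and fixes exactly two
points of `∂S`. -/
def IsLoxodromic (g : G) : Prop :=
  (∀ s : S, ¬ Bornology.IsBounded (Set.range fun n : ℤ => g ^ n • s)) ∧
    (MulAction.fixedBy (GromovBoundary S) g).encard = 2

variable (G S) in
/-- The action has unbounded orbits and there are two loxodromic elements with disjoint sets of
fixed points on `∂S`. -/
def IsGeneralType : Prop :=
  (∀ s : S, ¬ Bornology.IsBounded (MulAction.orbit G s)) ∧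
    ∃ g h : G, IsLoxodromic S g ∧ IsLoxodromic S h ∧
      Disjoint (MulAction.fixedBy (GromovBoundary S) g) (MulAction.fixedBy (GromovBoundary S) h)

variable (G S) in
/-- The elliptic radical `E_S(G)`: the elements that fix the limit set pointwise. -/
def ellipticRadical : Subgroup G :=
  fixingSubgroup G (limitSet G S : Set (GromovBoundary S))

end Action

/-- An action on a topological space is topologically free if the fixed point set of every
non-trivial element has empty interior. -/
def IsTopologicallyFree (G : Type u) [Group G] (X : Type v) [TopologicalSpace X]
    [MulAction G X] : Prop :=
  ∀ g : G, g ≠ 1 → interior (MulAction.fixedBy X g) = ∅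

/-- `G` has a general type isometric action on a hyperbolic space whose induced action on the
limit set is faithful. -/
def IsFaithfulWeaklyHyperbolic (G : Type u) [Group G] : Prop :=
  ∃ (S : Type v) (_ : MetricSpace S) (_ : HyperbolicSpace S) (_ : MulAction G S)
    (_ : IsIsometricSMul G S), IsGeneralType G S ∧ FaithfulSMul G (limitSet G S)

/-- `G` has a general type isometric action on a hyperbolic space whose induced action on the
limit set is topologically free. -/
def IsLimFree (G : Type u) [Group G] : Prop :=
  ∃ (S : Type v) (_ : MetricSpace S) (_ : HyperbolicSpace S) (_ : MulAction G S)
    (_ : IsIsometricSMul G S), IsGeneralType G S ∧ IsTopologicallyFree G (limitSet G S)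

/-- `G` satisfies the mixed identity `w = 1`, where `w` lies in the free product of `G` and the
free group of rank `n`: every homomorphism to `G` that is the identity on `G` kills `w`. -/
def SatisfiesMixedIdentity (G : Type u) [Group G] {n : ℕ}
    (w : Monoid.Coprod G (FreeGroup (Fin n))) : Prop :=
  ∀ φ : Monoid.Coprod G (FreeGroup (Fin n)) →* G,
    φ.comp Monoid.Coprod.inl = MonoidHom.id G → φ w = 1

/-- `G` is mixed identity free: it satisfies no non-trivial mixed identity. -/
def IsMixedIdentityFree (G : Type u) [Group G] : Prop :=
  ∀ (n : ℕ) (w : Monoid.Coprod G (FreeGroup (Fin n))), w ≠ 1 → ¬ SatisfiesMixedIdentity G w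

end HypGroup

/-!
The implications between the three conditions rest on the dynamics of `G` on the limit set; the
second condition implies the first because faithfulness on the limit set means that the elliptic
radical is trivial. All arguments are made with Gromov products of points of `S`: a point of the
bordification is replaced by a sequence that represents it, and `mem_basicNhd_of_frequently` and
`eventually_of_mem_basicNhd` translate between the neighbourhoods `U_o(a, r)` and products of
representatives.

A loxodromic element has a power with north-south dynamics (`exists_zpow_isAxial`), because a
horofunction centred at one of its fixed points restricts to an unbounded quasimorphism on the
cyclic group. Conjugates of two independent such elements then have both endpoints near any given
limit point (`IsGeneralType.exists_isAxial_mem`).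

If the action on the limit set is topologically free, the non-trivial coefficients of a reduced
word `w` of `G * F_n` move some limit point, hence move a neighbourhood of it off itself. Take
independent elements with north-south dynamics whose endpoints lie in this neighbourhood, and
substitute high powers of them for the variables. This turns `w` into a broken geodesic with long
segments whose corners have uniformly bounded Gromov products. By the local-to-global principle
`le_gromovProduct_wordEval`, the value of `w` moves the base point, and so it is not trivial.

Conversely, suppose that the elliptic radical is trivial and that some `g ≠ 1` fixes all limit
points in an open set. Conjugating `g` by high powers of an element with both endpoints in this
set, one gets elements `a₁` and `a₂` whose supports in the limit set lie in arbitrarily small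
neighbourhoods of two distinct points. For every `x` there are `i` and `j` such that `x` maps the
`i`-th neighbourhood off the `j`-th one: otherwise the cross ratio of four points would be large
and small at the same time (`exists_forall_notMem_basicNhd`). Hence for all `x` one of the
commutators `⁅x aᵢ x⁻¹, aⱼ⁆` is trivial, and nesting the four of them gives a mixed identity
(`IsMixedIdentityFree.exists_forall_commutator_ne`).
-/

namespace HypGroup

/-! ### Gromov products of points -/

section Product

variable {S : Type v} [MetricSpace S]

theorem gromovProduct_self (o x : S) : gromovProduct o x x = dist o x := by
  simp [gromovProduct, dist_comm]

theorem gromovProduct_le_dist_left (o x y : S) : gromovProduct o x y ≤ dist o x := by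
  have := dist_triangle y x o
  simp only [gromovProduct, dist_comm y x, dist_comm o x] at *
  linarith

theorem gromovProduct_le_dist_right (o x y : S) : gromovProduct o x y ≤ dist o y := by
  rw [gromovProduct_comm]
  exact gromovProduct_le_dist_left o y x

/-- The two Gromov products along a segment from `o` to `p` add up to its length. -/
theorem gromovProduct_swap_base (o p z : S) :
    gromovProduct p z o = dist o p - gromovProduct o z p := by
  simp only [gromovProduct, dist_comm p o]
  ring

theorem gromovProduct_sub_dist_le (o o' x y : S) :
    gromovProduct o x y - dist o o' ≤ gromovProduct o' x y := by
  have h1 := dist_triangle x o' o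
  have h2 := dist_triangle y o' o
  simp only [gromovProduct, dist_comm o o'] at *
  linarith

theorem gromovProduct_sub_dist_le_left (o x x' y : S) :
    gromovProduct o x y - dist x x' ≤ gromovProduct o x' y := by
  have h1 := dist_triangle x x' o
  have h2 := dist_triangle x' x y
  simp only [gromovProduct, dist_comm x' x] at *
  linarith

theorem gromovProduct_sub_dist_le_right (o x y y' : S) :
    gromovProduct o x y - dist y y' ≤ gromovProduct o x y' := by
  rw [gromovProduct_comm o x y, gromovProduct_comm o x y']
  exact gromovProduct_sub_dist_le_left o y y' x

/-- The cross ratio `⟨p|q⟩ + ⟨s|t⟩ - ⟨p|s⟩ - ⟨q|t⟩` does not depend on the base point. -/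
theorem gromovProduct_cross_ratio (o o' p q s t : S) :
    gromovProduct o p q + gromovProduct o s t - gromovProduct o p s - gromovProduct o q t =
      gromovProduct o' p q + gromovProduct o' s t - gromovProduct o' p s
        - gromovProduct o' q t := by
  simp only [gromovProduct]
  ring

/-- It suffices to check divergence of Gromov products for one base point. -/
theorem productTendsto_of_base (o : S) {x y : ℕ → S}
    (h : ∀ r : ℝ, ∃ N, ∀ i ≥ N, ∀ j ≥ N, r ≤ gromovProduct o (x i) (y j)) :
    ProductTendsto x y := by
  intro o'
  rw [tendsto_atTop]
  intro b
  obtain ⟨N, hN⟩ := h (b + dist o o')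
  filter_upwards [eventually_ge_atTop (N, N)] with p hp
  have h1 := hN p.1 hp.1 p.2 hp.2
  have h2 := gromovProduct_sub_dist_le o o' (x p.1) (y p.2)
  linarith

theorem ProductTendsto.exists_le {x y : ℕ → S} (h : ProductTendsto x y) (o : S) (r : ℝ) :
    ∃ N, ∀ i ≥ N, ∀ j ≥ N, r ≤ gromovProduct o (x i) (y j) := by
  obtain ⟨⟨N, M⟩, hN⟩ := eventually_atTop.1 (tendsto_atTop.1 (h o) r)
  exact ⟨max N M, fun i hi j hj => hN (i, j)
    ⟨(le_max_left _ _).trans hi, (le_max_right _ _).trans hj⟩⟩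

theorem gromovProduct_smul_smul {G : Type u} [Group G] [MulAction G S] [IsIsometricSMul G S]
    (k : G) (o z : S) :
    gromovProduct o (k • o) (k • z) = dist o (k⁻¹ • o) - gromovProduct o z (k⁻¹ • o) := by
  rw [← gromovProduct_swap_base, ← gromovProduct_smul k (k⁻¹ • o), smul_inv_smul,
    gromovProduct_comm]

variable (S) in
/-- A non-negative constant for the four-point condition of a hyperbolic space. -/
noncomputable def hypConst [HyperbolicSpace S] : ℝ :=
  max (HyperbolicSpace.hyperbolic (S := S)).choose 0

variable [HyperbolicSpace S]

theorem hypConst_nonneg : 0 ≤ hypConst S := le_max_right _ _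

theorem min_sub_hypConst_le (o x y z : S) :
    min (gromovProduct o x z) (gromovProduct o z y) - hypConst S ≤ gromovProduct o x y := by
  have h := (HyperbolicSpace.hyperbolic (S := S)).choose_spec x y z o
  have h' : (HyperbolicSpace.hyperbolic (S := S)).choose ≤ hypConst S := le_max_left _ _
  linarith

theorem sub_hypConst_le {o x y z : S} {r : ℝ} (h : r ≤ gromovProduct o x z)
    (h' : r ≤ gromovProduct o z y) : r - hypConst S ≤ gromovProduct o x y :=
  (sub_le_sub_right (le_min h h') _).trans (min_sub_hypConst_le o x y z)

/-- The form of the four-point condition that cancels a large product. -/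
theorem gromovProduct_le_of_lt {o x y z : S} {C : ℝ} (h : gromovProduct o x y ≤ C)
    (h' : C + hypConst S < gromovProduct o z y) : gromovProduct o x z ≤ C + hypConst S := by
  have h3 := min_sub_hypConst_le o x y z
  rcases min_choice (gromovProduct o x z) (gromovProduct o z y) with h1 | h1 <;>
    rw [h1] at h3 <;> linarith

end Product

/-! ### Sequences representing points of the bordification -/

section Represents

variable {S : Type v} [MetricSpace S] [HyperbolicSpace S]

/-- The sequence `x` represents the point `z` of the bordification: it is constant if `z` lies in
`S`, and it converges to `z` if `z` lies on the boundary. -/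
def Represents (x : ℕ → S) : Bordification S → Prop
  | .point y => ∀ i, x i = y
  | .bdry a => ∃ h : ProductTendsto x x, ConvergesTo ⟨x, h⟩ a

theorem exists_represents (z : Bordification S) : ∃ x : ℕ → S, Represents x z := by
  cases z with
  | point y => exact ⟨fun _ => y, fun _ => rfl⟩
  | bdry a =>
    induction a using Quotient.inductionOn with
    | h x => exact ⟨x.1, x.2, rfl⟩

theorem Represents.smul {G : Type u} [Group G] [MulAction G S] [IsIsometricSMul G S] (g : G)
    {x : ℕ → S} {z : Bordification S} (h : Represents x z) :
    Represents (fun i => g • x i) (g • z) := by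
  cases z with
  | point y => exact fun i => congrArg (g • ·) (h i)
  | bdry a =>
    obtain ⟨h1, h2⟩ := h
    exact ⟨h1.smul g, h2.smul g⟩

theorem Represents.productTendsto {x y : ℕ → S} {a : GromovBoundary S}
    (hx : Represents x (.bdry a)) (hy : Represents y (.bdry a)) : ProductTendsto x y := by
  obtain ⟨h1, rfl⟩ := hx
  obtain ⟨h2, h⟩ := hy
  exact (Quotient.exact h).symm

theorem Represents.congr {x y : ℕ → S} {a : GromovBoundary S} (hx : Represents x (.bdry a))
    (h : ProductTendsto x y) : Represents y (.bdry a) := by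
  obtain ⟨h1, rfl⟩ := hx
  exact ⟨h.symm.trans h, Quotient.sound h.symm⟩

/-- Representing a boundary point is stable under bounded perturbation. -/
theorem Represents.of_dist_le {x y : ℕ → S} {a : GromovBoundary S} (hx : Represents x (.bdry a))
    {C : ℝ} (h : ∀ i, dist (x i) (y i) ≤ C) : Represents y (.bdry a) := by
  refine hx.congr (productTendsto_of_base (x 0) fun r => ?_)
  obtain ⟨N, hN⟩ := (hx.productTendsto hx).exists_le (x 0) (r + C)
  refine ⟨N, fun i hi j hj => ?_⟩
  have h1 := hN i hi j hj
  have h2 := gromovProduct_sub_dist_le_right (x 0) (x i) (x j) (y j)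
  have h3 := h j
  linarith

theorem lt_gromovProduct_of_mem_basicNhd {o : S} {a : GromovBoundary S} {z : Bordification S}
    {r : ℝ} (h : z ∈ basicNhd o a r) {x w : ℕ → S} (hx : Represents x (.bdry a))
    (hw : Represents w z) : ∃ N, ∀ i ≥ N, ∀ j ≥ N, r < gromovProduct o (x i) (w j) := by
  obtain ⟨hx1, hx2⟩ := hx
  have h : (r : EReal) < extGromovProduct o a z := h
  cases z with
  | point y =>
    have h2 := lt_of_lt_of_le h (iInf_le _ ⟨⟨x, hx1⟩, hx2⟩)
    obtain ⟨N, hN⟩ := eventually_atTop.1 (eventually_lt_of_lt_liminf h2)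
    refine ⟨N, fun i hi j _ => ?_⟩
    rw [hw j]
    exact EReal.coe_lt_coe_iff.1 (hN i hi)
  | bdry b =>
    obtain ⟨hw1, hw2⟩ := hw
    have h2 := lt_of_lt_of_le h (iInf₂_le
      (⟨⟨x, hx1⟩, hx2⟩ : {x : SeqAtInfinity S // ConvergesTo x a})
      (⟨⟨w, hw1⟩, hw2⟩ : {y : SeqAtInfinity S // ConvergesTo y b}))
    obtain ⟨⟨N, M⟩, hN⟩ := eventually_atTop.1 (eventually_lt_of_lt_liminf h2)
    exact ⟨max N M, fun i hi j hj => EReal.coe_lt_coe_iff.1 (hN (i, j)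
      ⟨(le_max_left _ _).trans hi, (le_max_right _ _).trans hj⟩)⟩

theorem eventually_of_mem_basicNhd {o : S} {a : GromovBoundary S} {z : Bordification S}
    {r : ℝ} (h : z ∈ basicNhd o a r) {x w : ℕ → S} (hx : Represents x (.bdry a))
    (hw : Represents w z) : ∀ᶠ i in atTop, r < gromovProduct o (x i) (w i) := by
  obtain ⟨N, hN⟩ := lt_gromovProduct_of_mem_basicNhd h hx hw
  exact eventually_atTop.2 ⟨N, fun i hi => hN i hi i hi⟩

/-- If one pair of representatives has infinitely often a large Gromov product, then all pairs
have eventually a large Gromov product, up to twice the hyperbolicity constant. -/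
theorem mem_basicNhd_of_frequently {o : S} {a : GromovBoundary S} {z : Bordification S}
    {r s : ℝ} {x w : ℕ → S} (hx : Represents x (.bdry a)) (hw : Represents w z)
    (h : ∃ᶠ i in atTop, s ≤ gromovProduct o (x i) (w i)) (hs : r + 2 * hypConst S < s) :
    z ∈ basicNhd o a r := by
  have hlt : (r : EReal) < ((s - 2 * hypConst S : ℝ) : EReal) :=
    EReal.coe_lt_coe_iff.2 (by linarith)
  have h0 := hypConst_nonneg (S := S)
  refine lt_of_lt_of_le hlt ?_
  cases z with
  | point y =>
    refine le_iInf fun x' => ?_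
    refine le_liminf_of_le (by isBoundedDefault) ?_
    have hr : Represents x'.1.1 (.bdry a) := ⟨x'.1.2, x'.2⟩
    obtain ⟨N, hN⟩ := (hr.productTendsto hx).exists_le o s
    obtain ⟨i, hi, hi'⟩ := frequently_atTop.1 h N
    filter_upwards [eventually_ge_atTop N] with k hk
    rw [hw i] at hi'
    have := sub_hypConst_le (hN k hk i hi) hi'
    exact EReal.coe_le_coe_iff.2 (by linarith)
  | bdry b =>
    refine le_iInf₂ fun x' y' => ?_
    refine le_liminf_of_le (by isBoundedDefault) ?_
    have hr : Represents x'.1.1 (.bdry a) := ⟨x'.1.2, x'.2⟩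
    have hr' : Represents y'.1.1 (.bdry b) := ⟨y'.1.2, y'.2⟩
    obtain ⟨N, hN⟩ := (hr.productTendsto hx).exists_le o s
    obtain ⟨M, hM⟩ := (hw.productTendsto hr').exists_le o s
    obtain ⟨i, hi, hi'⟩ := frequently_atTop.1 h (max N M)
    filter_upwards [eventually_ge_atTop (N, M)] with k hk
    have h1 := sub_hypConst_le (hN k.1 hk.1 i ((le_max_left _ _).trans hi)) hi'
    have h2 := sub_hypConst_le h1 (le_trans (by linarith)
      (hM i ((le_max_right _ _).trans hi) k.2 hk.2))
    exact EReal.coe_le_coe_iff.2 (by linarith)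

theorem eventually_lt_of_notMem_basicNhd {o : S} {a : GromovBoundary S} {z : Bordification S}
    {r s : ℝ} {x w : ℕ → S} (hx : Represents x (.bdry a)) (hw : Represents w z)
    (h : z ∉ basicNhd o a r) (hs : r + 2 * hypConst S < s) :
    ∀ᶠ i in atTop, gromovProduct o (x i) (w i) < s := by
  by_contra hc
  refine h (mem_basicNhd_of_frequently hx hw (Filter.not_eventually.1 hc |>.mono ?_) hs)
  exact fun i hi => not_lt.1 hi

/-- The ultrametric-type inequality for points of the bordification. -/
theorem mem_basicNhd_trans {o : S} {a b : GromovBoundary S} {z : Bordification S} {r s : ℝ}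
    (h : Bordification.bdry b ∈ basicNhd o a s) (h' : z ∈ basicNhd o b s)
    (hs : r + 3 * hypConst S < s) : z ∈ basicNhd o a r := by
  obtain ⟨x, hx⟩ := exists_represents (.bdry a : Bordification S)
  obtain ⟨y, hy⟩ := exists_represents (.bdry b : Bordification S)
  obtain ⟨w, hw⟩ := exists_represents z
  refine mem_basicNhd_of_frequently (s := s - hypConst S) hx hw (Eventually.frequently ?_)
    (by linarith)
  filter_upwards [eventually_of_mem_basicNhd h hx hy, eventually_of_mem_basicNhd h' hy hw]
    with i h1 h2
  exact sub_hypConst_le h1.le h2.le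

theorem mem_basicNhd_self (o : S) (a : GromovBoundary S) (r : ℝ) :
    Bordification.bdry a ∈ basicNhd o a r := by
  obtain ⟨x, hx⟩ := exists_represents (.bdry a : Bordification S)
  obtain ⟨N, hN⟩ := (hx.productTendsto hx).exists_le o (r + 2 * hypConst S + 1)
  exact mem_basicNhd_of_frequently hx hx
    (Eventually.frequently (eventually_atTop.2 ⟨N, fun i hi => hN i hi i hi⟩)) (by linarith)

/-- Distinct boundary points have a finite Gromov product. -/
theorem exists_notMem_basicNhd (o : S) {a b : GromovBoundary S} (h : a ≠ b) :
    ∃ r : ℝ, Bordification.bdry b ∉ basicNhd o a r := by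
  by_contra! hc
  obtain ⟨x, hx⟩ := exists_represents (.bdry a : Bordification S)
  obtain ⟨y, hy⟩ := exists_represents (.bdry b : Bordification S)
  have hp : ProductTendsto x y := productTendsto_of_base o fun r => by
    obtain ⟨N, hN⟩ := lt_gromovProduct_of_mem_basicNhd (hc r) hx hy
    exact ⟨N, fun i hi j hj => (hN i hi j hj).le⟩
  obtain ⟨_, rfl⟩ := hx
  obtain ⟨_, rfl⟩ := hy
  exact h (Quotient.sound hp)

theorem exists_eventually_le_of_ne (o : S) {a b : GromovBoundary S} (h : a ≠ b) {x y : ℕ → S}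
    (hx : Represents x (.bdry a)) (hy : Represents y (.bdry b)) :
    ∃ C, ∀ᶠ i in atTop, gromovProduct o (x i) (y i) ≤ C := by
  obtain ⟨r, hr⟩ := exists_notMem_basicNhd o h
  exact ⟨r + 2 * hypConst S + 1,
    (eventually_lt_of_notMem_basicNhd hx hy hr (by linarith)).mono fun i hi => hi.le⟩

/-- A sequence represents `a` as soon as it enters all sets `U_o(a, r)`. -/
theorem represents_of_eventually_mem (o : S) {a : GromovBoundary S} {p : ℕ → S}
    (h : ∀ r : ℝ, ∀ᶠ k in atTop, Bordification.point (p k) ∈ basicNhd o a r) :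
    Represents p (.bdry a) := by
  obtain ⟨x, hx⟩ := exists_represents (.bdry a : Bordification S)
  refine hx.congr (productTendsto_of_base o fun r => ?_)
  obtain ⟨N, hN⟩ := (hx.productTendsto hx).exists_le o (r + hypConst S)
  obtain ⟨M, hM⟩ := eventually_atTop.1 (h (r + hypConst S))
  refine ⟨max N M, fun i hi k hk => ?_⟩
  obtain ⟨L, hL⟩ := lt_gromovProduct_of_mem_basicNhd (hM k ((le_max_right _ _).trans hk)) hx
    (w := fun _ => p k) (fun _ => rfl)
  have h1 := hN i ((le_max_left _ _).trans hi) (max N L) (le_max_left _ _)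
  have h2 := hL (max N L) (le_max_right _ _) L le_rfl
  have := sub_hypConst_le h1 h2.le
  linarith

theorem Represents.eventually_mem (o : S) {a : GromovBoundary S} {p : ℕ → S}
    (hp : Represents p (.bdry a)) (r : ℝ) :
    ∀ᶠ k in atTop, Bordification.point (p k) ∈ basicNhd o a r := by
  obtain ⟨N, hN⟩ := (hp.productTendsto hp).exists_le o (r + 2 * hypConst S + 1)
  filter_upwards [eventually_ge_atTop N] with k hk
  exact mem_basicNhd_of_frequently hp (w := fun _ => p k) (fun _ => rfl) (Eventually.frequently
    (eventually_atTop.2 ⟨N, fun i hi => hN i hi k hk⟩)) (by linarith)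

theorem mem_basicNhd_base (o o' : S) {a : GromovBoundary S} {z : Bordification S} {r s : ℝ}
    (h : z ∈ basicNhd o a s) (hs : r + dist o o' + 2 * hypConst S < s) :
    z ∈ basicNhd o' a r := by
  obtain ⟨x, hx⟩ := exists_represents (.bdry a : Bordification S)
  obtain ⟨w, hw⟩ := exists_represents z
  refine mem_basicNhd_of_frequently (s := s - dist o o') hx hw (Eventually.frequently ?_)
    (by linarith)
  filter_upwards [eventually_of_mem_basicNhd h hx hw] with i hi
  have := gromovProduct_sub_dist_le o o' (x i) (w i)
  linarith

theorem mem_basicNhd_point {o p q : S} {a : GromovBoundary S} {r s : ℝ}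
    (h : Bordification.point p ∈ basicNhd o a s) (hs : r + dist p q + 2 * hypConst S < s) :
    Bordification.point q ∈ basicNhd o a r := by
  obtain ⟨x, hx⟩ := exists_represents (.bdry a : Bordification S)
  refine mem_basicNhd_of_frequently (s := s - dist p q) hx (w := fun _ => q) (fun _ => rfl)
    (Eventually.frequently ?_) (by linarith)
  filter_upwards [eventually_of_mem_basicNhd h hx (w := fun _ => p) (fun _ => rfl)] with i hi
  have := gromovProduct_sub_dist_le_right o (x i) p q
  linarith

end Represents

/-! ### The topology of the boundary and the limit set -/

section BoundaryTopology

variable {S : Type v} [MetricSpace S] [HyperbolicSpace S]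

/-- The sets `U_o(a, r)` need not be open, but they are neighbourhoods of `a`: their interior
contains the points that have a neighbourhood of basic form in `U_o(a, r)`. -/
theorem basicNhd_mem_nhds (o : S) (a : GromovBoundary S) (r : ℝ) :
    basicNhd o a r ∈ 𝓝 (Bordification.bdry a) := by
  set U := basicNhd o a r with hU
  let W : Set (Bordification S) :=
    {z | (∀ x, z = .point x → {y : S | Bordification.point y ∈ U} ∈ 𝓝 x) ∧
      ∀ b, z = .bdry b → ∃ s, basicNhd o b s ⊆ U}
  have hWU : W ⊆ U := by
    rintro (x | b) ⟨h1, h2⟩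
    · exact mem_of_mem_nhds (s := {y : S | Bordification.point y ∈ U}) (h1 x rfl)
    · obtain ⟨s, hs⟩ := h2 b rfl
      exact hs (mem_basicNhd_self o b s)
  have haW : Bordification.bdry a ∈ W := by
    refine ⟨fun x hx => (by cases hx), fun b hb => ?_⟩
    cases hb
    exact ⟨r, hU.ge⟩
  refine mem_of_superset (IsOpen.mem_nhds (s := W) ⟨?_, fun b hb o' => ?_⟩ haW) hWU
  · have : {x : S | Bordification.point x ∈ W} =
        interior {y : S | Bordification.point y ∈ U} := by
      ext x
      rw [mem_interior_iff_mem_nhds]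
      constructor
      · exact fun h => h.1 x rfl
      · refine fun h => ⟨fun y hy => ?_, fun b hb => (by cases hb)⟩
        cases hy
        exact h
    rw [this]
    exact isOpen_interior
  · obtain ⟨s, hs⟩ := hb.2 b rfl
    have h0 := hypConst_nonneg (S := S)
    refine ⟨s + 5 * hypConst S + dist o' o + 3, fun z hz => ?_⟩
    have hz' : z ∈ basicNhd o b (s + 3 * hypConst S + 2) :=
      mem_basicNhd_base o' o hz (by linarith)
    refine ⟨?_, ?_⟩
    · rintro x rfl
      refine mem_of_superset (Metric.ball_mem_nhds x one_pos) fun y hy => hs ?_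
      have hy' : dist x y < 1 := Metric.mem_ball'.1 hy
      exact mem_basicNhd_point hz' (by linarith)
    · rintro c rfl
      exact ⟨s + 3 * hypConst S + 2, fun w hw =>
        hs (mem_basicNhd_trans hz' hw (by linarith))⟩

theorem boundary_hasBasis_nhds (o : S) (a : GromovBoundary S) :
    (𝓝 a).HasBasis (fun _ : ℝ => True)
      fun r => {b | Bordification.bdry b ∈ basicNhd o a r} := by
  refine ⟨fun V => ?_⟩
  rw [nhds_induced, mem_comap]
  constructor
  · rintro ⟨U, hU, hUV⟩
    obtain ⟨W, hWU, hW, haW⟩ := mem_nhds_iff.1 hU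
    obtain ⟨r, hr⟩ := hW.2 a haW o
    exact ⟨r, trivial, fun b hb => hUV (hWU (hr hb))⟩
  · rintro ⟨r, -, hr⟩
    exact ⟨_, basicNhd_mem_nhds o a r, hr⟩

theorem exists_disjoint_basicNhd (o : S) {a b : GromovBoundary S} (h : a ≠ b) :
    ∃ r : ℝ, Disjoint (basicNhd o a r) (basicNhd o b r) := by
  obtain ⟨R, hR⟩ := exists_notMem_basicNhd o h
  refine ⟨R + 3 * hypConst S + 1, Set.disjoint_left.2 fun z hz hz' => hR ?_⟩
  obtain ⟨x, hx⟩ := exists_represents (.bdry a : Bordification S)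
  obtain ⟨y, hy⟩ := exists_represents (.bdry b : Bordification S)
  obtain ⟨w, hw⟩ := exists_represents z
  refine mem_basicNhd_of_frequently (s := R + 3 * hypConst S + 1 - hypConst S) hx hy
    (Eventually.frequently ?_) (by linarith)
  filter_upwards [eventually_of_mem_basicNhd hz hx hw, eventually_of_mem_basicNhd hz' hy hw]
    with i h1 h2
  exact sub_hypConst_le h1.le (by rw [gromovProduct_comm]; exact h2.le)

instance boundaryT2 : T2Space (GromovBoundary S) := by
  rw [t2Space_iff_disjoint_nhds]
  intro a b hab
  obtain ⟨x, -⟩ := exists_represents (Bordification.bdry a)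
  obtain ⟨R, hR⟩ := exists_disjoint_basicNhd (x 0) hab
  exact ((boundary_hasBasis_nhds (x 0) a).disjoint_iff (boundary_hasBasis_nhds (x 0) b)).2
    ⟨R, trivial, R, trivial, hR.preimage _⟩

variable {G : Type u} [Group G] [MulAction G S] [IsIsometricSMul G S]

instance boundaryContinuousConstSMul : ContinuousConstSMul G (GromovBoundary S) :=
  ⟨fun g => continuous_induced_rng.2 (Continuous.comp (f := Bordification.bdry)
    (continuous_smul_bordification (S := S) g) continuous_induced_dom)⟩

theorem exists_smul_mem_basicNhd {a : GromovBoundary S} (ha : a ∈ limitSet G S) (o : S) (r : ℝ) :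
    ∃ k : G, Bordification.point (k • o) ∈ basicNhd o a r := by
  obtain ⟨s, hs⟩ := ha
  obtain ⟨_, hz, k, rfl⟩ := mem_closure_iff_nhds.1 hs _
    (basicNhd_mem_nhds o a (r + dist s o + 2 * hypConst S + 1))
  exact ⟨k, mem_basicNhd_point hz (by rw [dist_smul]; linarith)⟩

theorem mem_limitSet_of_represents {a : GromovBoundary S} (o : S) {k : ℕ → G}
    (h : Represents (fun n => k n • o) (.bdry a)) : a ∈ limitSet G S := by
  refine ⟨o, ?_⟩
  rw [mem_closure_iff]
  intro U hU haU
  obtain ⟨r, hr⟩ := hU.2 a haU o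
  obtain ⟨n, hn⟩ := (h.eventually_mem o r).exists
  exact ⟨_, hr hn, k n, rfl⟩

end BoundaryTopology

/-! ### Dynamics of loxodromic elements -/

section Axial

variable {G : Type u} [Group G] {S : Type v} [MetricSpace S] [MulAction G S]
  [HyperbolicSpace S]

/-- The element `f` has the distinct attracting point `a` and repelling point `b`: the sequences
`f ^ n • o` and `f ^ (-n) • o` converge to `a` and `b`. -/
def IsAxial (f : G) (a b : GromovBoundary S) : Prop :=
  a ≠ b ∧ (∀ o : S, Represents (fun n : ℕ => f ^ n • o) (.bdry a)) ∧
    ∀ o : S, Represents (fun n : ℕ => f⁻¹ ^ n • o) (.bdry b)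

theorem IsAxial.inv {f : G} {a b : GromovBoundary S} (h : IsAxial f a b) : IsAxial f⁻¹ b a :=
  ⟨h.1.symm, h.2.2, by simpa using h.2.1⟩

variable [IsIsometricSMul G S]

theorem represents_conj {f : G} {a : GromovBoundary S} (k : G)
    (h : ∀ o : S, Represents (fun n : ℕ => f ^ n • o) (.bdry a)) (o : S) :
    Represents (fun n : ℕ => (k * f * k⁻¹) ^ n • o) (.bdry (k • a)) := by
  have h1 := (h (k⁻¹ • o)).smul k
  rw [smul_bdry] at h1
  convert h1 using 2 with n
  rw [conj_pow, mul_smul, mul_smul]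

theorem IsAxial.conj {f : G} {a b : GromovBoundary S} (h : IsAxial f a b) (k : G) :
    IsAxial (k * f * k⁻¹) (k • a) (k • b) := by
  refine ⟨fun hab => h.1 (smul_left_cancel k hab), represents_conj k h.2.1, ?_⟩
  have : (k * f * k⁻¹)⁻¹ = k * f⁻¹ * k⁻¹ := by group
  rw [this]
  exact represents_conj k h.2.2

theorem represents_eq {x : ℕ → S} {a b : GromovBoundary S} (ha : Represents x (.bdry a))
    (hb : Represents x (.bdry b)) : a = b := by
  obtain ⟨_, rfl⟩ := ha
  obtain ⟨_, rfl⟩ := hb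
  rfl

theorem IsAxial.smul_left {f : G} {a b : GromovBoundary S} (h : IsAxial f a b) : f • a = a := by
  obtain ⟨x, -⟩ := exists_represents (Bordification.bdry a)
  refine represents_eq ((h.2.1 (x 0)).smul f) ((h.2.1 (x 0)).of_dist_le (C := dist (x 0) (f • x 0))
    fun n => ?_)
  rw [← mul_smul, ← pow_succ', pow_succ, mul_smul, dist_smul]

theorem IsAxial.left_mem {f : G} {a b : GromovBoundary S} (h : IsAxial f a b) :
    a ∈ limitSet G S := by
  obtain ⟨x, -⟩ := exists_represents (Bordification.bdry a)
  exact mem_limitSet_of_represents (x 0) (h.2.1 (x 0))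

theorem Represents.tendsto_dist {x : ℕ → S} {a : GromovBoundary S} (h : Represents x (.bdry a))
    (o : S) : Tendsto (fun n => dist o (x n)) atTop atTop := by
  rw [tendsto_atTop]
  intro r
  obtain ⟨N, hN⟩ := (h.productTendsto h).exists_le o r
  filter_upwards [eventually_ge_atTop N] with n hn
  rw [← gromovProduct_self]
  exact hN n hn n hn

/-- North-south dynamics: high powers of `f` send all boundary points outside a neighbourhood of
the repelling point into a given neighbourhood of the attracting point. -/
theorem IsAxial.eventually_mem {f : G} {a b : GromovBoundary S} (h : IsAxial f a b) (o : S)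
    (R r : ℝ) : ∀ᶠ n : ℕ in atTop, ∀ c : GromovBoundary S,
      Bordification.bdry c ∉ basicNhd o b R → Bordification.bdry (f ^ n • c) ∈ basicNhd o a r := by
  have h0 := hypConst_nonneg (S := S)
  have hx := h.2.1 o
  have hy := h.2.2 o
  set s := r + 2 * hypConst S + 1 with hs
  obtain ⟨N, hN⟩ := (hx.productTendsto hx).exists_le o (s + hypConst S)
  obtain ⟨M, hM⟩ := (hy.productTendsto hy).exists_le o (R + 3 * hypConst S + 2)
  filter_upwards [eventually_ge_atTop N, eventually_ge_atTop M,
    tendsto_atTop.1 (hy.tendsto_dist o) (s + hypConst S + (R + 3 * hypConst S + 1))]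
    with n hnN hnM hn c hc
  obtain ⟨z, hz⟩ := exists_represents (Bordification.bdry c)
  refine mem_basicNhd_of_frequently (s := s) hx (hz.smul (f ^ n)) (Eventually.frequently ?_)
    (by linarith)
  filter_upwards [eventually_ge_atTop N, eventually_ge_atTop M,
    eventually_lt_of_notMem_basicNhd hy hz hc (s := R + 2 * hypConst S + 1) (by linarith)]
    with i hiN hiM hi
  have h1 : gromovProduct o (z i) (f⁻¹ ^ n • o) ≤ R + 2 * hypConst S + 1 + hypConst S := by
    refine gromovProduct_le_of_lt (y := f⁻¹ ^ i • o) ?_ ?_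
    · rw [gromovProduct_comm]
      exact hi.le
    · have := hM n hnM i hiM
      linarith
  have h2 := gromovProduct_smul_smul (f ^ n) o (z i)
  rw [← inv_pow] at h2
  have h3 := sub_hypConst_le (hN i hiN n hnN) (y := f ^ n • z i) (by linarith)
  linarith

/-- If `k • o` is near `c`, then so is `k • p`, unless `k⁻¹ • o` is near `p`. -/
theorem smul_mem_basicNhd {o : S} {k : G} {c p : GromovBoundary S} {r t R : ℝ}
    (hk : Bordification.point (k • o) ∈ basicNhd o c t)
    (hp : Bordification.point (k⁻¹ • o) ∉ basicNhd o p R)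
    (hR : 0 ≤ R) (ht : r + R + 5 * hypConst S + 1 < t) :
    Bordification.bdry (k • p) ∈ basicNhd o c r := by
  have h0 := hypConst_nonneg (S := S)
  obtain ⟨x, hx⟩ := exists_represents (Bordification.bdry c)
  obtain ⟨w, hw⟩ := exists_represents (Bordification.bdry p)
  have hkp : Represents (fun _ => k⁻¹ • o) (.point (k⁻¹ • o)) := fun _ => rfl
  refine mem_basicNhd_of_frequently (s := t - R - 3 * hypConst S - 1) hx (hw.smul k)
    (Eventually.frequently ?_) (by linarith)
  filter_upwards [eventually_of_mem_basicNhd hk hx (w := fun _ => k • o) (fun _ => rfl),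
    eventually_lt_of_notMem_basicNhd hw hkp hp
    (s := R + 2 * hypConst S + 1) (by linarith)] with i h1 h2
  have h3 := gromovProduct_le_dist_right o (x i) (k • o)
  have h4 : dist o (k⁻¹ • o) = dist o (k • o) := by
    rw [← dist_smul k, smul_inv_smul, dist_comm]
  have h5 := gromovProduct_smul_smul k o (w i)
  have h6 := sub_hypConst_le (o := o) (x := x i) (y := k • w i) (z := k • o)
    (r := t - R - 2 * hypConst S - 1) (by linarith) (by linarith)
  linarith

/-- Every limit point is approximated by the pairs of endpoints of the conjugates of one of two
given independent elements: `k⁻¹ • o` cannot be near endpoints of both. -/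
theorem exists_conj_mem_basicNhd {a b c d : GromovBoundary S} (hac : a ≠ c) (had : a ≠ d)
    (hbc : b ≠ c) (hbd : b ≠ d) {ξ : GromovBoundary S} (hξ : ξ ∈ limitSet G S) (o : S) (r : ℝ) :
    ∃ k : G, (Bordification.bdry (k • a) ∈ basicNhd o ξ r ∧
        Bordification.bdry (k • b) ∈ basicNhd o ξ r) ∨
      (Bordification.bdry (k • c) ∈ basicNhd o ξ r ∧
        Bordification.bdry (k • d) ∈ basicNhd o ξ r) := by
  obtain ⟨R, hR0, hR⟩ : ∃ R : ℝ, 0 ≤ R ∧ ∀ z, ¬ ((z ∈ basicNhd o a R ∨ z ∈ basicNhd o b R) ∧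
      (z ∈ basicNhd o c R ∨ z ∈ basicNhd o d R)) := by
    obtain ⟨R1, h1⟩ := exists_disjoint_basicNhd o hac
    obtain ⟨R2, h2⟩ := exists_disjoint_basicNhd o had
    obtain ⟨R3, h3⟩ := exists_disjoint_basicNhd o hbc
    obtain ⟨R4, h4⟩ := exists_disjoint_basicNhd o hbd
    have H : ∀ {p q : GromovBoundary S} {R R' : ℝ}, Disjoint (basicNhd o p R) (basicNhd o q R) →
        R ≤ R' → ∀ z, z ∈ basicNhd o p R' → z ∉ basicNhd o q R' := fun hd hle z hz hz' =>
      Set.disjoint_left.1 hd (basicNhd_anti o _ hle hz) (basicNhd_anti o _ hle hz')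
    have l1 := le_max_left (max R1 R2) (max R3 R4)
    have l2 := le_max_right (max R1 R2) (max R3 R4)
    have l3 := le_max_left (max (max R1 R2) (max R3 R4)) 0
    refine ⟨max (max (max R1 R2) (max R3 R4)) 0, le_max_right _ _, ?_⟩
    rintro z ⟨ha | hb, hc | hd⟩
    · exact H h1 (((le_max_left _ _).trans l1).trans l3) z ha hc
    · exact H h2 (((le_max_right _ _).trans l1).trans l3) z ha hd
    · exact H h3 (((le_max_left _ _).trans l2).trans l3) z hb hc
    · exact H h4 (((le_max_right _ _).trans l2).trans l3) z hb hd
  obtain ⟨k, hk⟩ := exists_smul_mem_basicNhd hξ o (r + R + 5 * hypConst S + 2)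
  refine ⟨k, ?_⟩
  by_cases h : Bordification.point (k⁻¹ • o) ∈ basicNhd o a R ∨
      Bordification.point (k⁻¹ • o) ∈ basicNhd o b R
  · have h' := not_or.1 fun h' => hR _ ⟨h, h'⟩
    exact Or.inr ⟨smul_mem_basicNhd hk h'.1 hR0 (by linarith),
      smul_mem_basicNhd hk h'.2 hR0 (by linarith)⟩
  · push Not at h
    exact Or.inl ⟨smul_mem_basicNhd hk h.1 hR0 (by linarith),
      smul_mem_basicNhd hk h.2 hR0 (by linarith)⟩

end Axial

/-! ### Loxodromic elements have powers with north-south dynamics -/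

/-- An unbounded quasimorphism on `ℤ` tends at linear speed to `-∞` along the positive multiples of
some integer, and to `∞` along the negative ones. -/
theorem exists_mul_quasimorphism_le {β : ℤ → ℝ} {D : ℝ}
    (hβ : ∀ n m, |β (n + m) - β n - β m| ≤ D) (hub : ∀ K : ℝ, ∃ n, K < |β n|) :
    ∃ m : ℤ, ∀ k : ℕ, β (m * k) ≤ D - k ∧ (k : ℝ) - D ≤ β (-(m * k)) := by
  have h0 : |β 0| ≤ D := by
    have := hβ 0 0
    simpa using this
  obtain ⟨m, hm, hm'⟩ : ∃ m : ℤ, β m ≤ -(D + 1) ∧ D + 1 ≤ β (-m) := by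
    obtain ⟨n, hn⟩ := hub (3 * D + 1)
    have h1 := abs_le.1 (hβ n (-n))
    have h2 := abs_le.1 h0
    rw [add_neg_cancel] at h1
    rcases lt_abs.1 hn with h | h
    · exact ⟨-n, by linarith, by rw [neg_neg]; linarith⟩
    · exact ⟨n, by linarith, by linarith⟩
  refine ⟨m, fun k => ?_⟩
  have h2 := abs_le.1 h0
  induction k with
  | zero => simpa using h2.symm
  | succ k ih =>
    have e1 := abs_le.1 (hβ (m * k) m)
    have e2 := abs_le.1 (hβ (-(m * k)) (-m))
    have r1 : m * ((k + 1 : ℕ) : ℤ) = m * k + m := by push_cast; ring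
    have r2 : -(m * k + m) = -(m * (k : ℤ)) + -m := by ring
    rw [r1, r2]
    push_cast
    obtain ⟨ih1, ih2⟩ := ih
    clear r1 r2
    constructor
    · linarith [e1.1, e1.2]
    · linarith [e2.1, e2.2]

section Loxodromic

variable {G : Type u} [Group G] {S : Type v} [MetricSpace S] [MulAction G S]
  [IsIsometricSMul G S] [HyperbolicSpace S]

/-- Points that are far out in the same direction have almost the same product with `p`. Hence
the value at `p` of a horofunction is determined up to a uniform error by its centre. -/
theorem abs_gromovProduct_sub_le {o p x x' : S} (h : dist o p ≤ gromovProduct o x x') :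
    |gromovProduct o x p - gromovProduct o x' p| ≤ hypConst S := by
  have h1 := gromovProduct_le_dist_right o x p
  have h2 := gromovProduct_le_dist_right o x' p
  have h3 := sub_hypConst_le (o := o) (y := p) (h2.trans h) le_rfl
  have h4 := sub_hypConst_le (o := o) (y := p) (x := x') (z := x)
    ((h1.trans h).trans_eq (gromovProduct_comm _ _ _)) le_rfl
  rw [abs_le]
  constructor <;> linarith

/-- An isometry with unbounded orbits that fixes two boundary points has a power with north-south
dynamics between them. The horofunction centred at the first point restricts to a quasimorphism
on the orbit, and it is close to the displacement up to sign, as the orbit stays close to the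
geodesics between the two points. -/
theorem exists_zpow_isAxial {g : G} {ξ η : GromovBoundary S} (hne : ξ ≠ η) (hξ : g • ξ = ξ)
    (hη : g • η = η) (hg : ∀ s : S, ¬ Bornology.IsBounded (Set.range fun n : ℤ => g ^ n • s)) :
    ∃ m : ℤ, IsAxial (g ^ m) ξ η := by
  have hδ := hypConst_nonneg (S := S)
  obtain ⟨x, hx⟩ := exists_represents (Bordification.bdry ξ)
  obtain ⟨y, hy⟩ := exists_represents (Bordification.bdry η)
  set o := x 0 with ho
  have hξ' : ∀ n : ℤ, g ^ n • ξ = ξ := fun n =>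
    (MulAction.mem_stabilizer_iff (G := G)).1 (zpow_mem (MulAction.mem_stabilizer_iff.2 hξ) n)
  have hη' : ∀ n : ℤ, g ^ n • η = η := fun n =>
    (MulAction.mem_stabilizer_iff (G := G)).1 (zpow_mem (MulAction.mem_stabilizer_iff.2 hη) n)
  have hx' : ∀ n : ℤ, Represents (fun i => g ^ n • x i) (.bdry ξ) := fun n => by
    simpa [smul_bdry, hξ'] using hx.smul (g ^ n)
  have hy' : ∀ n : ℤ, Represents (fun i => g ^ n • y i) (.bdry η) := fun n => by
    simpa [smul_bdry, hη'] using hy.smul (g ^ n)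
  obtain ⟨R, hR⟩ := exists_notMem_basicNhd o hne
  set C := R + 2 * hypConst S + 1 with hC
  have hline : ∀ n : ℤ, ∀ᶠ i in atTop, gromovProduct (g ^ n • o) (x i) (y i) ≤ C := fun n => by
    filter_upwards [eventually_lt_of_notMem_basicNhd (hx' (-n)) (hy' (-n)) hR
      (s := C) (by linarith)] with i hi
    rw [← gromovProduct_smul (g ^ (-n)), ← mul_smul, ← zpow_add, neg_add_cancel, zpow_zero,
      one_smul]
    exact hi.le
  -- `b i n` approximates the horofunction centred at `ξ` at the orbit point `g ^ n • o`
  set b : ℕ → ℤ → ℝ := fun i n => dist (x i) (g ^ n • o) - dist (x i) o with hb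
  have hbp : ∀ i n, b i n = dist o (g ^ n • o) - 2 * gromovProduct o (x i) (g ^ n • o) :=
    fun i n => by
      simp only [hb, gromovProduct, dist_comm (g ^ n • o) o]
      ring
  have hlim : ∀ n : ℤ, ∃ β : ℝ, ∀ᶠ i in atTop, |b i n - β| ≤ 2 * hypConst S := fun n => by
    obtain ⟨N, hN⟩ := (hx.productTendsto hx).exists_le o (dist o (g ^ n • o))
    refine ⟨b N n, eventually_atTop.2 ⟨N, fun i hi => ?_⟩⟩
    have h1 := abs_le.1 (abs_gromovProduct_sub_le (hN i hi N le_rfl))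
    rw [hbp, hbp, abs_le]
    constructor <;> linarith
  choose β hβ using hlim
  have hquasi : ∀ n m : ℤ, |β (n + m) - β n - β m| ≤ 8 * hypConst S := fun n m => by
    obtain ⟨N, hN⟩ := (hx.productTendsto (hx' (-n))).exists_le o (dist o (g ^ m • o))
    obtain ⟨i, h1, h2, h3, hi⟩ := ((hβ (n + m)).and ((hβ n).and ((hβ m).and
      (eventually_ge_atTop N)))).exists
    have h4 := abs_le.1 (abs_gromovProduct_sub_le (hN i hi i hi))
    have h5 : b i (n + m) - b i n =
        dist o (g ^ m • o) - 2 * gromovProduct o (g ^ (-n) • x i) (g ^ m • o) := by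
      have e1 : dist (x i) (g ^ (n + m) • o) = dist (g ^ (-n) • x i) (g ^ m • o) := by
        rw [← dist_smul (g ^ n) (g ^ (-n) • x i), zpow_neg, smul_inv_smul, zpow_add, mul_smul]
      have e2 : dist (x i) (g ^ n • o) = dist (g ^ (-n) • x i) o := by
        rw [← dist_smul (g ^ n) (g ^ (-n) • x i), zpow_neg, smul_inv_smul]
      simp only [hb, e1, e2, gromovProduct, dist_comm (g ^ m • o) o]
      ring
    have h6 := hbp i m
    rw [abs_le] at h1 h2 h3 ⊢
    constructor <;> linarith
  have hdist : ∀ n : ℤ, dist o (g ^ n • o) ≤ |β n| + 4 * C + 4 * hypConst S := fun n => by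
    obtain ⟨i, h1, h2, h3⟩ := ((hβ n).and ((hline 0).and (hline n))).exists
    rw [zpow_zero, one_smul] at h2
    have h4 := min_sub_hypConst_le o (x i) (y i) (g ^ n • o)
    have h5 := abs_le.1 h1
    have h6 := le_abs_self (β n)
    have h7 := neg_abs_le (β n)
    have hC0 : 0 ≤ C := le_trans (by
      have := dist_triangle (x i) o (y i)
      simp only [gromovProduct, dist_comm (y i) o]
      linarith) h2
    rcases min_choice (gromovProduct o (x i) (g ^ n • o)) (gromovProduct o (g ^ n • o) (y i))
      with h | h <;> rw [h] at h4 <;>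
      simp only [hb, gromovProduct, dist_comm (y i), dist_comm (g ^ n • o) o] at * <;> linarith
  have hub : ∀ K : ℝ, ∃ n, K < |β n| := fun K => by
    by_contra! hK
    refine hg o ((Metric.isBounded_iff_subset_closedBall o).2
      ⟨K + 4 * C + 4 * hypConst S, ?_⟩)
    rintro _ ⟨n, rfl⟩
    rw [Metric.mem_closedBall']
    have := hdist n
    have := hK n
    linarith
  obtain ⟨m, hm⟩ := exists_mul_quasimorphism_le hquasi hub
  refine ⟨m, hne, fun p => ?_, fun p => ?_⟩
  · suffices h : Represents (fun n : ℕ => (g ^ m) ^ n • o) (.bdry ξ) from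
      h.of_dist_le (C := dist o p) fun n => by rw [dist_smul]
    refine represents_of_eventually_mem o fun r => ?_
    obtain ⟨N, hN⟩ := exists_nat_gt (2 * (r + 2 * hypConst S + 1) + 10 * hypConst S)
    filter_upwards [eventually_ge_atTop N] with k hk
    have hk' : (N : ℝ) ≤ k := Nat.cast_le.2 hk
    refine mem_basicNhd_of_frequently (s := r + 2 * hypConst S + 1) hx
      (w := fun _ => (g ^ m) ^ k • o) (fun _ => rfl) (Eventually.frequently ?_) (by linarith)
    filter_upwards [hβ (m * k)] with i hi
    have h1 := hbp i (m * k)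
    rw [zpow_mul, zpow_natCast] at h1
    have h2 := (hm k).1
    have h3 := abs_le.1 hi
    have h4 := dist_nonneg (x := o) (y := (g ^ m) ^ k • o)
    linarith
  · suffices h : Represents (fun n : ℕ => (g ^ m)⁻¹ ^ n • o) (.bdry η) from
      h.of_dist_le (C := dist o p) fun n => by rw [dist_smul]
    refine represents_of_eventually_mem o fun r => ?_
    obtain ⟨N, hN⟩ := exists_nat_gt (2 * (r + 2 * hypConst S + 1) + 10 * hypConst S + 2 * C)
    filter_upwards [eventually_ge_atTop N] with k hk
    have hk' : (N : ℝ) ≤ k := Nat.cast_le.2 hk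
    refine mem_basicNhd_of_frequently (s := r + 2 * hypConst S + 1) hy
      (w := fun _ => (g ^ m)⁻¹ ^ k • o) (fun _ => rfl) (Eventually.frequently ?_) (by linarith)
    filter_upwards [hβ (-(m * k)), hline (-(m * k))] with i hi hi'
    have e : g ^ (-(m * (k : ℤ))) = (g ^ m)⁻¹ ^ k := by
      rw [zpow_neg, zpow_mul, zpow_natCast, inv_pow]
    have h2 := (hm k).2
    have h3 := abs_le.1 hi
    have h5 := dist_nonneg (x := o) (y := (g ^ m)⁻¹ ^ k • o)
    have h6 := dist_triangle (x i) o (y i)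
    simp only [hb, e] at h3
    rw [e] at hi'
    simp only [gromovProduct, dist_comm (y i), dist_comm ((g ^ m)⁻¹ ^ k • o) o] at *
    linarith

/-- A general type action has two independent elements with north-south dynamics. -/
theorem IsGeneralType.exists_isAxial (h : IsGeneralType G S) :
    ∃ (f f' : G) (a b c d : GromovBoundary S), IsAxial f a b ∧ IsAxial f' c d ∧
      a ≠ c ∧ a ≠ d ∧ b ≠ c ∧ b ≠ d := by
  obtain ⟨-, g, g', ⟨hg, hgf⟩, ⟨hg', hgf'⟩, hd⟩ := h
  obtain ⟨a, b, hab, he⟩ := Set.encard_eq_two.1 hgf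
  obtain ⟨c, d, hcd, he'⟩ := Set.encard_eq_two.1 hgf'
  have ha : a ∈ MulAction.fixedBy (GromovBoundary S) g := he ▸ Set.mem_insert _ _
  have hb : b ∈ MulAction.fixedBy (GromovBoundary S) g := he ▸ Set.mem_insert_of_mem _ rfl
  have hc : c ∈ MulAction.fixedBy (GromovBoundary S) g' := he' ▸ Set.mem_insert _ _
  have hd' : d ∈ MulAction.fixedBy (GromovBoundary S) g' := he' ▸ Set.mem_insert_of_mem _ rfl
  obtain ⟨m, hm⟩ := exists_zpow_isAxial hab ha hb hg
  obtain ⟨m', hm'⟩ := exists_zpow_isAxial hcd hc hd' hg'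
  exact ⟨_, _, a, b, c, d, hm, hm', hd.ne_of_mem ha hc, hd.ne_of_mem ha hd',
    hd.ne_of_mem hb hc, hd.ne_of_mem hb hd'⟩

/-- Near each limit point there is a pair of endpoints that avoids a given finite set. -/
theorem IsGeneralType.exists_isAxial_mem (h : IsGeneralType G S) {V : Set (GromovBoundary S)}
    {ξ : GromovBoundary S} (hξ : ξ ∈ limitSet G S) (hV : V ∈ 𝓝 ξ)
    (P : Finset (GromovBoundary S)) :
    ∃ (f : G) (a b : GromovBoundary S), IsAxial f a b ∧ a ∈ V ∧ b ∈ V ∧ a ∉ P ∧ b ∉ P := by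
  classical
  obtain ⟨U, hUV, hU, hξU⟩ := mem_nhds_iff.1 hV
  obtain ⟨z, -⟩ := exists_represents (Bordification.bdry ξ)
  set o := z 0
  obtain ⟨r, -, hr⟩ := (boundary_hasBasis_nhds o ξ).mem_iff.1 (hU.mem_nhds hξU)
  obtain ⟨f, f', a, b, c, d, hf, haU, hf', hac, had, hbc, hbd⟩ :
      ∃ (f f' : G) (a b c d : GromovBoundary S), IsAxial f a b ∧ a ∈ U ∧ IsAxial f' c d ∧
        a ≠ c ∧ a ≠ d ∧ b ≠ c ∧ b ≠ d := by
    obtain ⟨f, f', a, b, c, d, hf, hf', hac, had, hbc, hbd⟩ := h.exists_isAxial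
    obtain ⟨k, hk | hk⟩ := exists_conj_mem_basicNhd hac had hbc hbd hξ o r
    · refine ⟨_, _, _, _, _, _, hf.conj k, hr hk.1, hf'.conj k, ?_, ?_, ?_, ?_⟩ <;>
        simpa [smul_left_cancel_iff]
    · refine ⟨_, _, _, _, _, _, hf'.conj k, hr hk.1, hf.conj k, ?_, ?_, ?_, ?_⟩ <;>
        simpa [smul_left_cancel_iff] using Ne.symm ‹_›
  -- the conjugates of `f'` by high powers of `f` have both endpoints near `a`, but not at `a`
  have hW : U \ ((P.erase a : Finset _) : Set (GromovBoundary S)) ∈ 𝓝 a :=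
    inter_mem (hU.mem_nhds haU)
      ((Finset.isClosed _).isOpen_compl.mem_nhds (by simp))
  obtain ⟨s, -, hs⟩ := (boundary_hasBasis_nhds o a).mem_iff.1 hW
  obtain ⟨R1, h1⟩ := exists_notMem_basicNhd o hbc
  obtain ⟨R2, h2⟩ := exists_notMem_basicNhd o hbd
  obtain ⟨n, hn1, hn2⟩ := ((hf.eventually_mem o R1 s).and (hf.eventually_mem o R2 s)).exists
  have h3 := hs (hn1 c h1)
  have h4 := hs (hn2 d h2)
  have hfix : f ^ n • a = a :=
    (MulAction.mem_stabilizer_iff (G := G)).1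
      (pow_mem (MulAction.mem_stabilizer_iff.2 hf.smul_left) n)
  have h5 : f ^ n • c ≠ a := fun e => hac (smul_left_cancel (f ^ n) (hfix.trans e.symm))
  have h6 : f ^ n • d ≠ a := fun e => had (smul_left_cancel (f ^ n) (hfix.trans e.symm))
  exact ⟨_, _, _, hf'.conj (f ^ n), hUV h3.1, hUV h4.1,
    fun hP => h3.2 (Finset.mem_coe.2 (Finset.mem_erase.2 ⟨h5, hP⟩)),
    fun hP => h4.2 (Finset.mem_coe.2 (Finset.mem_erase.2 ⟨h6, hP⟩))⟩

end Loxodromic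

/-! ### From topological freeness to mixed identity freeness -/

section Chain

variable {G : Type u} [Group G]

/-- A letter `(i, ε)` stands for the generator `i` if `ε` is `true`, and for its inverse otherwise.
A list of pairs `(c, l)` of coefficients and letters stands for the word `c₁ l₁ c₂ l₂ ⋯`; it is
evaluated in a group `H` through the values of coefficients and letters. -/
def wordEval {α H : Type*} [Group H] (ι : G →* H) (val : α × Bool → H)
    (L : List (G × (α × Bool))) : H :=
  (L.map fun p => ι p.1 * val p.2).prod

/-- No letter of the word is followed by the trivial coefficient and its own inverse. -/
def IsReducedWord {α : Type*} (L : List (G × (α × Bool))) : Prop :=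
  L.IsChain fun p q => q.1 = 1 → q.2 ≠ (p.2.1, !p.2.2)

/-- The value of a letter in the free product of `G` and a free group. -/
def letterVal {α : Type*} (l : α × Bool) : Monoid.Coprod G (FreeGroup α) :=
  Monoid.Coprod.inr (if l.2 then FreeGroup.of l.1 else (FreeGroup.of l.1)⁻¹)

theorem letterVal_mul_letterVal_not {α : Type*} (i : α) (ε : Bool) :
    letterVal (G := G) (i, ε) * letterVal (i, !ε) = 1 := by
  cases ε <;> simp [letterVal]

/-- Every element of the free product is a reduced word followed by a coefficient. -/
theorem exists_isReducedWord {α : Type*} [DecidableEq α] (w : Monoid.Coprod G (FreeGroup α)) :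
    ∃ (L : List (G × (α × Bool))) (c : G), IsReducedWord L ∧
      w = wordEval Monoid.Coprod.inl letterVal L * Monoid.Coprod.inl c := by
  classical
  let Q (w : Monoid.Coprod G (FreeGroup α)) : Prop :=
    ∃ (L : List (G × (α × Bool))) (c : G), IsReducedWord L ∧
      w = wordEval Monoid.Coprod.inl letterVal L * Monoid.Coprod.inl c
  have hletter : ∀ (l : α × Bool) (w), Q w → Q (letterVal l * w) := by
    rintro ⟨i, ε⟩ _ ⟨L, c, hL, rfl⟩
    by_cases h : ∃ L', L = (1, (i, !ε)) :: L'
    · obtain ⟨L', rfl⟩ := h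
      refine ⟨L', c, hL.tail, ?_⟩
      simp only [wordEval, List.map_cons, List.prod_cons, map_one, one_mul, ← mul_assoc,
        letterVal_mul_letterVal_not]
    · refine ⟨(1, (i, ε)) :: L, c, ?_, by simp [wordEval, mul_assoc]⟩
      cases L with
      | nil => exact List.isChain_singleton _
      | cons p L' =>
        refine List.isChain_cons_cons.2 ⟨fun h1 h2 => h ⟨L', ?_⟩, hL⟩
        rw [← h1, ← h2]
  have hcoef : ∀ (g : G) (w), Q w → Q (Monoid.Coprod.inl g * w) := by
    rintro g _ ⟨L, c, hL, rfl⟩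
    cases L with
    | nil => exact ⟨[], g * c, hL, by simp [wordEval]⟩
    | cons p L' =>
      refine ⟨(g * p.1, p.2) :: L', c, ?_, by simp [wordEval, mul_assoc]⟩
      cases L' with
      | nil => exact List.isChain_singleton _
      | cons q L'' =>
        rw [IsReducedWord, List.isChain_cons_cons] at hL ⊢
        exact hL
  have hfree : ∀ (f : FreeGroup α) (w), Q w → Q (Monoid.Coprod.inr f * w) := by
    intro f
    induction f using FreeGroup.induction_on with
    | C1 => simp
    | of i => simpa [letterVal] using hletter (i, true)
    | inv_of i _ => simpa [letterVal] using hletter (i, false)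
    | mul x y hx hy =>
      intro w hw
      rw [map_mul, mul_assoc]
      exact hx _ (hy _ hw)
  have hall : ∀ u w : Monoid.Coprod G (FreeGroup α), Q w → Q (u * w) := by
    intro u
    induction u using Monoid.Coprod.induction_on with
    | inl g => exact hcoef g
    | inr f => exact hfree f
    | mul x y hx hy =>
      intro w hw
      rw [mul_assoc]
      exact hx _ (hy _ hw)
  have := hall w 1 ⟨[], 1, List.isChain_nil, by simp [wordEval]⟩
  rwa [mul_one] at this

variable {S : Type v} [MetricSpace S] [MulAction G S] [IsIsometricSMul G S] [HyperbolicSpace S]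

/-- The local-to-global principle for broken geodesics: if the segments have length at least
`E + C + δ` and the Gromov products at the corners are at most `C`, then the end point has a
product of at least `E` with the first corner. In particular it has distance at least `E` from the
origin. -/
theorem le_gromovProduct_wordEval {α : Type*} (o : S) (val : α × Bool → G) {C E : ℝ}
    (hE : C + hypConst S < E) (hC : 0 ≤ C) (L : List (G × (α × Bool)))
    (hlen : ∀ p ∈ L, E + C + hypConst S ≤ dist o ((p.1 * val p.2) • o))
    (hang : L.IsChain fun p q =>
      gromovProduct o ((p.1 * val p.2)⁻¹ • o) ((q.1 * val q.2) • o) ≤ C)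
    (p : G × (α × Bool)) (hp : L.head? = some p) :
    E ≤ gromovProduct o (wordEval (MonoidHom.id G) val L • o) ((p.1 * val p.2) • o) := by
  have h0 := hypConst_nonneg (S := S)
  induction L generalizing p with
  | nil => simp at hp
  | cons q L ih =>
    obtain rfl : q = p := by simpa using hp
    have hq := hlen q (by simp)
    cases L with
    | nil =>
      simp only [wordEval, List.map_cons, List.map_nil, List.prod_cons, List.prod_nil, mul_one,
        MonoidHom.id_apply, gromovProduct_self]
      linarith
    | cons q' L =>
      obtain ⟨h1, h2⟩ := List.isChain_cons_cons.1 hang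
      have h3 := ih (fun p hp => hlen p (List.mem_cons_of_mem _ hp)) h2 q' rfl
      set v := wordEval (MonoidHom.id G) val (q' :: L) with hv
      have h4 : wordEval (MonoidHom.id G) val (q :: q' :: L) = q.1 * val q.2 * v := by
        rw [hv]
        simp [wordEval]
      rw [h4, mul_smul, gromovProduct_comm, gromovProduct_smul_smul, gromovProduct_comm]
      have h5 := gromovProduct_le_of_lt h1 (hE.trans_le h3)
      have h6 : dist o ((q.1 * val q.2)⁻¹ • o) = dist o ((q.1 * val q.2) • o) := by
        rw [← dist_smul (q.1 * val q.2), smul_inv_smul, dist_comm]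
      linarith

end Chain

section LimFree

variable {G : Type u} [Group G] {S : Type v} [MetricSpace S] [MulAction G S]
  [IsIsometricSMul G S] [HyperbolicSpace S]

/-- For a topologically free action, finitely many non-trivial elements move some limit point. -/
theorem exists_mem_limitSet_forall_smul_ne (hgen : IsGeneralType G S)
    (hfree : IsTopologicallyFree G (limitSet G S)) (F : Finset G) :
    ∃ ξ ∈ limitSet G S, ∀ g ∈ F, g ≠ 1 → g • ξ ≠ ξ := by
  have hcont : ∀ g : G, Continuous fun x : limitSet G S => g • x := fun g =>
    Continuous.subtype_mk ((continuous_const_smul g).comp continuous_subtype_val) _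
  have hdense : Dense (⋂₀ ((fun g => (MulAction.fixedBy (limitSet G S) g)ᶜ) ''
      {g ∈ (F : Set G) | g ≠ 1})) := by
    refine ((F.finite_toSet.subset (Set.sep_subset _ _)).image _).dense_sInter ?_ ?_
    · rintro _ ⟨g, -, rfl⟩
      exact (isClosed_eq (hcont g) continuous_id).isOpen_compl
    · rintro _ ⟨g, hg, rfl⟩
      exact interior_eq_empty_iff_dense_compl.1 (hfree g hg.2)
  obtain ⟨f, f', a, b, c, d, hf, -⟩ := hgen.exists_isAxial
  have : Nonempty (limitSet G S) := ⟨⟨a, hf.left_mem⟩⟩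
  obtain ⟨ξ, hξ⟩ := hdense.nonempty
  refine ⟨ξ.1, ξ.2, fun g hg hg1 h => ?_⟩
  exact Set.mem_sInter.1 hξ _ ⟨g, ⟨hg, hg1⟩, rfl⟩ (Subtype.ext h)

/-- In a Hausdorff space, a point moved by finitely many homeomorphisms has a neighbourhood that
each of them moves off itself. -/
theorem exists_nhds_forall_smul_ne {X : Type*} [TopologicalSpace X] [T2Space X] [MulAction G X]
    [ContinuousConstSMul G X] {ξ : X} {F : Finset G} (h : ∀ g ∈ F, g • ξ ≠ ξ) :
    ∃ V ∈ 𝓝 ξ, ∀ g ∈ F, ∀ u ∈ V, ∀ v ∈ V, g • u ≠ v := by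
  have h1 : ∀ g : G, ∃ V ∈ 𝓝 ξ, g ∈ F → ∀ u ∈ V, ∀ v ∈ V, g • u ≠ v := fun g => by
    by_cases hg : g ∈ F
    · obtain ⟨U, W, hU, hW, hξU, hξW, hd⟩ := t2_separation (h g hg)
      refine ⟨(g • ·) ⁻¹' U ∩ W, inter_mem
        ((continuous_const_smul g).continuousAt.preimage_mem_nhds (hU.mem_nhds hξU))
        (hW.mem_nhds hξW), fun _ u hu v hv => hd.ne_of_mem hu.1 hv.2⟩
    · exact ⟨Set.univ, univ_mem, fun h => absurd h hg⟩
  choose V hV hV' using h1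
  refine ⟨⋂ g ∈ F, V g, (biInter_finset_mem F).2 fun g _ => hV g, fun g hg u hu v hv => ?_⟩
  exact hV' g hg u (Set.mem_iInter₂.1 hu g hg) v (Set.mem_iInter₂.1 hv g hg)

theorem exists_forall_eventually_le {ι : Type*} (s : Finset ι) (f : ι → ℕ → ℝ)
    (h : ∀ i ∈ s, ∃ C, ∀ᶠ n in atTop, f i n ≤ C) :
    ∃ C, 0 ≤ C ∧ ∀ᶠ n in atTop, ∀ i ∈ s, f i n ≤ C := by
  classical
  induction s using Finset.induction_on with
  | empty => exact ⟨0, le_rfl, by simp⟩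
  | insert i s _ ih =>
    obtain ⟨C, hC0, hC⟩ := ih fun j hj => h j (Finset.mem_insert_of_mem hj)
    obtain ⟨C', hC'⟩ := h i (Finset.mem_insert_self _ _)
    refine ⟨max C C', hC0.trans (le_max_left _ _), ?_⟩
    filter_upwards [hC, hC'] with n h1 h2 j hj
    rcases Finset.mem_insert.1 hj with rfl | hj
    · exact h2.trans (le_max_right _ _)
    · exact (h1 j hj).trans (le_max_left _ _)

/-- A sequence of elements with north-south dynamics and pairwise distinct endpoints in `V`. -/
theorem IsGeneralType.exists_seq_isAxial (hgen : IsGeneralType G S) {V : Set (GromovBoundary S)}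
    {ξ : GromovBoundary S} (hξ : ξ ∈ limitSet G S) (hV : V ∈ 𝓝 ξ) :
    ∃ (f : ℕ → G) (pt : ℕ × Bool → GromovBoundary S),
      (∀ n, IsAxial (f n) (pt (n, true)) (pt (n, false))) ∧ (∀ l, pt l ∈ V) ∧
        Function.Injective pt := by
  classical
  obtain ⟨t, ht, hd⟩ := exists_seq_of_forall_finset_exists
    (fun t : G × GromovBoundary S × GromovBoundary S =>
      IsAxial t.1 t.2.1 t.2.2 ∧ t.2.1 ∈ V ∧ t.2.2 ∈ V)
    (fun s t => (s.2.1 ≠ t.2.1 ∧ s.2.2 ≠ t.2.1) ∧ (s.2.1 ≠ t.2.2 ∧ s.2.2 ≠ t.2.2))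
    (fun s _ => by
      obtain ⟨f, a, b, hf, ha, hb, haP, hbP⟩ := hgen.exists_isAxial_mem hξ hV
        (s.image (fun t => t.2.1) ∪ s.image (fun t => t.2.2))
      simp only [Finset.mem_union, Finset.mem_image, not_or, not_exists, not_and] at haP hbP
      exact ⟨(f, a, b), ⟨hf, ha, hb⟩, fun x hx =>
        ⟨⟨haP.1 x hx, haP.2 x hx⟩, ⟨hbP.1 x hx, hbP.2 x hx⟩⟩⟩)
  refine ⟨fun n => (t n).1, fun l => if l.2 then (t l.1).2.1 else (t l.1).2.2,
    fun n => (ht n).1, ?_, ?_⟩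
  · rintro ⟨n, _ | _⟩
    · exact (ht n).2.2
    · exact (ht n).2.1
  · rintro ⟨m, ε⟩ ⟨n, ε'⟩ h
    rcases lt_trichotomy m n with hmn | rfl | hmn
    · have := hd m n hmn
      cases ε <;> cases ε' <;> simp_all
    · have := (ht m).1.1
      cases ε <;> cases ε' <;> simp_all
    · have := hd n m hmn
      cases ε <;> cases ε' <;> simp_all [eq_comm]

/-- Substituting high powers of independent loxodromic elements, whose endpoints lie in a small
open set that the coefficients of a reduced word move off itself, turns the word into a broken
geodesic to which the local-to-global principle applies. -/
theorem isMixedIdentityFree_of_isTopologicallyFree (hgen : IsGeneralType G S)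
    (hfree : IsTopologicallyFree G (limitSet G S)) : IsMixedIdentityFree G := by
  classical
  intro n w hw hsat
  have h0 := hypConst_nonneg (S := S)
  obtain ⟨L, c, hL, rfl⟩ := exists_isReducedWord w
  rcases L with _ | ⟨p₀, L₀⟩
  -- without letters, `w` is a coefficient, which no substitution changes
  · refine hw ?_
    have := hsat (Monoid.Coprod.lift (MonoidHom.id G) 1) (Monoid.Coprod.lift_comp_inl _ _)
    simp only [wordEval, List.map_nil, List.prod_nil, one_mul, Monoid.Coprod.lift_apply_inl,
      MonoidHom.id_apply] at this ⊢
    rw [this, map_one]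
  generalize hLL : p₀ :: L₀ = L at *
  obtain ⟨ξ, hξ, hmove⟩ := exists_mem_limitSet_forall_smul_ne hgen hfree
    (L.toFinset.image Prod.fst)
  obtain ⟨V, hV, hVmove⟩ := exists_nhds_forall_smul_ne (ξ := ξ)
    (F := (L.toFinset.image Prod.fst).filter (· ≠ 1))
    (fun g hg => hmove g (Finset.mem_filter.1 hg).1 (Finset.mem_filter.1 hg).2)
  obtain ⟨f, pt, hf, hptV, hinj⟩ := hgen.exists_seq_isAxial hξ hV
  obtain ⟨z, -⟩ := exists_represents (Bordification.bdry ξ)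
  set o := z 0
  let val (N : ℕ) (l : Fin n × Bool) : G := if l.2 then f l.1 ^ N else (f l.1)⁻¹ ^ N
  let P (l : Fin n × Bool) : GromovBoundary S := pt ((l.1 : ℕ), l.2)
  have hP : Function.Injective P := fun l l' h => by
    have := hinj h
    simp only [Prod.mk.injEq] at this
    exact Prod.ext (Fin.ext this.1) this.2
  have hval : ∀ l, Represents (fun N => val N l • o) (.bdry (P l)) := by
    rintro ⟨i, _ | _⟩
    · simpa [val] using (hf i).2.2 o
    · simpa [val] using (hf i).2.1 o
  have hinv : ∀ N i ε, (val N (i, ε))⁻¹ = val N (i, !ε) := by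
    rintro N i (_ | _) <;> simp [val]
  have hforward : ∀ p : G × (Fin n × Bool),
      Represents (fun N => (p.1 * val N p.2) • o) (.bdry (p.1 • P p.2)) := fun p => by
    have := (hval p.2).smul p.1
    simpa only [mul_smul, smul_bdry] using this
  have hbackward : ∀ p : G × (Fin n × Bool),
      Represents (fun N => (p.1 * val N p.2)⁻¹ • o) (.bdry (P (p.2.1, !p.2.2))) := fun p => by
    refine (hval (p.2.1, !p.2.2)).of_dist_le (C := dist o (p.1⁻¹ • o)) fun N => ?_
    rw [mul_inv_rev, ← hinv, mul_smul, dist_smul]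
  -- `hne` says that `pq.1` and `pq.2` may follow each other in a reduced word
  obtain ⟨C, hC0, hC⟩ := exists_forall_eventually_le
    ((L.toFinset ×ˢ L.toFinset).filter fun pq =>
      pq.2.1 = 1 → pq.2.2 ≠ (pq.1.2.1, !pq.1.2.2))
    (fun pq N => gromovProduct o ((pq.1.1 * val N pq.1.2)⁻¹ • o) ((pq.2.1 * val N pq.2.2) • o))
    (fun pq hpq => by
      obtain ⟨hmem, hne⟩ := Finset.mem_filter.1 hpq
      refine exists_eventually_le_of_ne o (fun h => ?_) (hbackward pq.1) (hforward pq.2)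
      by_cases h1 : pq.2.1 = 1
      · rw [h1, one_smul] at h
        exact hne h1 (hP h).symm
      · exact hVmove pq.2.1 (Finset.mem_filter.2 ⟨Finset.mem_image_of_mem _
          (Finset.mem_product.1 hmem).2, h1⟩) _ (hptV _) _ (hptV _) h.symm)
  set E := max (C + hypConst S + 1) (dist o (c⁻¹ • o) + 1) with hE
  have hlen : ∀ᶠ N in atTop, ∀ p ∈ L.toFinset,
      E + C + hypConst S ≤ dist o ((p.1 * val N p.2) • o) :=
    (eventually_all_finset _).2 fun p _ =>
      tendsto_atTop.1 ((hforward p).tendsto_dist o) _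
  obtain ⟨N, hN1, hN2⟩ := (hC.and hlen).exists
  have hchain := le_gromovProduct_wordEval o (val N) (C := C) (E := E)
    (lt_of_lt_of_le (by linarith) (le_max_left _ _)) hC0 L
    (fun p hp => hN2 p (List.mem_toFinset.2 hp))
    (hL.imp_of_mem_imp fun p q hp hq h => hN1 (p, q) (Finset.mem_filter.2
      ⟨Finset.mem_product.2 ⟨List.mem_toFinset.2 hp, List.mem_toFinset.2 hq⟩, h⟩))
    p₀ (by rw [← hLL]; rfl)
  have hφ := hsat (Monoid.Coprod.lift (MonoidHom.id G) (FreeGroup.lift fun i : Fin n => f i ^ N))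
    (Monoid.Coprod.lift_comp_inl _ _)
  have heval : ∀ L : List (G × (Fin n × Bool)),
      Monoid.Coprod.lift (MonoidHom.id G) (FreeGroup.lift fun i : Fin n => f i ^ N)
        (wordEval Monoid.Coprod.inl letterVal L) = wordEval (MonoidHom.id G) (val N) L :=
    fun L => by
      rw [wordEval, wordEval, map_list_prod, List.map_map]
      congr 2
      funext ⟨g, i, ε⟩
      cases ε <;> simp [letterVal, val]
  rw [map_mul, heval, Monoid.Coprod.lift_apply_inl, MonoidHom.id_apply] at hφ
  rw [eq_inv_of_mul_eq_one_left hφ] at hchain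
  have h1 := gromovProduct_le_dist_left o (c⁻¹ • o) ((p₀.1 * val N p₀.2) • o)
  have h2 := le_max_right (C + hypConst S + 1) (dist o (c⁻¹ • o) + 1)
  linarith

end LimFree

/-! ### From mixed identity freeness to topological freeness -/

section FreeProduct

open Monoid
open scoped commutatorElement

theorem neWord_prod_ne_one {ι : Type*} {M : ι → Type*} [∀ i, Monoid (M i)] [DecidableEq ι]
    [∀ i, DecidableEq (M i)] {i j : ι} (w : CoprodI.NeWord M i j) : w.prod ≠ 1 := by
  intro h
  have h1 : w.toWord = CoprodI.Word.empty :=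
    CoprodI.Word.equiv.symm.injective (h.trans CoprodI.Word.prod_empty.symm)
  exact w.toList_ne_nil (congrArg CoprodI.Word.toList h1)

/-- The reduced word of the commutator `⁅u, y v y⁻¹⁆` for a new letter `y`. -/
theorem exists_neWord_commutator {ι : Type*} {M : ι → Type*} [∀ i, Group (M i)] {i j k : ι}
    (hi : k ≠ i) (hj : k ≠ j) (u v : CoprodI.NeWord M i j) (y : M k) (hy : y ≠ 1) :
    ∃ w : CoprodI.NeWord M i k,
      w.prod = ⁅u.prod, CoprodI.of y * v.prod * (CoprodI.of y)⁻¹⁆ := by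
  let s := CoprodI.NeWord.singleton y hy
  refine ⟨((((((u.append hj.symm s).append hi v).append hj.symm s.inv).append hj
    u.inv).append hi.symm s).append hj v.inv).append hi.symm s.inv, ?_⟩
  simp [s, commutatorElement_def, mul_assoc]

theorem exists_neWord_conj_commutator {ι : Type*} {M : ι → Type*} [∀ i, Group (M i)] {i j : ι}
    (hij : i ≠ j) {x : M i} {a b : M j} (hx : x ≠ 1) (ha : a ≠ 1) (hb : b ≠ 1) :
    ∃ w : CoprodI.NeWord M i j,
      w.prod = ⁅CoprodI.of x * CoprodI.of a * (CoprodI.of x)⁻¹, CoprodI.of b⁆ := by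
  let X := CoprodI.NeWord.singleton x hx
  let A := CoprodI.NeWord.singleton a ha
  let B := CoprodI.NeWord.singleton b hb
  refine ⟨((((((X.append hij A).append hij.symm X.inv).append hij B).append hij.symm
    X).append hij A.inv).append hij.symm X.inv).append hij B.inv, ?_⟩
  simp [X, A, B, commutatorElement_def, mul_assoc]

/-- In a mixed identity free group, one conjugator `x` works for four commutators at once. The
mixed identity nests the four commutators, with two additional variables that prevent
cancellation. -/
theorem IsMixedIdentityFree.exists_forall_commutator_ne {G : Type u} [Group G]
    (h : IsMixedIdentityFree G) {a b : G} (ha : a ≠ 1) (hb : b ≠ 1) :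
    ∃ x : G, (⁅x * a * x⁻¹, a⁆ ≠ 1 ∧ ⁅x * a * x⁻¹, b⁆ ≠ 1) ∧
      ⁅x * b * x⁻¹, a⁆ ≠ 1 ∧ ⁅x * b * x⁻¹, b⁆ ≠ 1 := by
  classical
  let W {H : Type u} [Group H] (x y z a b : H) : H :=
    ⁅⁅⁅x * a * x⁻¹, a⁆, y * ⁅x * a * x⁻¹, b⁆ * y⁻¹⁆,
      z * ⁅⁅x * b * x⁻¹, a⁆, y * ⁅x * b * x⁻¹, b⁆ * y⁻¹⁆ * z⁻¹⁆
  have hW : ∀ {H K : Type u} [Group H] [Group K] (φ : H →* K) (x y z a b : H),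
      φ (W x y z a b) = W (φ x) (φ y) (φ z) (φ a) (φ b) := fun φ x y z a b => by
    simp only [W, map_commutatorElement, map_mul, map_inv]
  let X (i : Fin 3) : Coprod G (FreeGroup (Fin 3)) := Coprod.inr (FreeGroup.of i)
  have hne : W (X 0) (X 1) (X 2) (Coprod.inl a) (Coprod.inl b) ≠ 1 := by
    -- all factors of the target are the same group, to avoid a dependent family
    let M : Fin 4 → Type u := fun _ => G × Multiplicative ℤ
    let t : G × Multiplicative ℤ := (1, Multiplicative.ofAdd 1)
    have ht : t ≠ 1 := fun h => by simpa [t] using congrArg Prod.snd h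
    have ha' : ((a, 1) : G × Multiplicative ℤ) ≠ 1 := fun h => ha (congrArg Prod.fst h)
    have hb' : ((b, 1) : G × Multiplicative ℤ) ≠ 1 := fun h => hb (congrArg Prod.fst h)
    let φ : Coprod G (FreeGroup (Fin 3)) →* CoprodI M :=
      Coprod.lift ((CoprodI.of (M := M) (i := 0)).comp (MonoidHom.inl G (Multiplicative ℤ)))
        (FreeGroup.lift fun i => CoprodI.of (M := M) (i := i.succ) t)
    obtain ⟨w1, h1⟩ := exists_neWord_conj_commutator (M := M) (i := 1) (j := 0) (by decide)
      ht ha' ha'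
    obtain ⟨w2, h2⟩ := exists_neWord_conj_commutator (M := M) (i := 1) (j := 0) (by decide)
      ht ha' hb'
    obtain ⟨w3, h3⟩ := exists_neWord_conj_commutator (M := M) (i := 1) (j := 0) (by decide)
      ht hb' ha'
    obtain ⟨w4, h4⟩ := exists_neWord_conj_commutator (M := M) (i := 1) (j := 0) (by decide)
      ht hb' hb'
    obtain ⟨w5, h5⟩ := exists_neWord_commutator (k := 2) (by decide) (by decide) w1 w2 t ht
    obtain ⟨w6, h6⟩ := exists_neWord_commutator (k := 2) (by decide) (by decide) w3 w4 t ht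
    obtain ⟨w7, h7⟩ := exists_neWord_commutator (k := 3) (by decide) (by decide) w5 w6 t ht
    intro h
    refine neWord_prod_ne_one w7 ?_
    rw [h7, h5, h6, h1, h2, h3, h4]
    have := congrArg φ h
    rw [hW, map_one] at this
    exact this
  have h1 := h 3 _ hne
  simp only [SatisfiesMixedIdentity, not_forall] at h1
  obtain ⟨φ, hφ, hφw⟩ := h1
  have hφ' : ∀ g, φ (Coprod.inl g) = g := fun g => DFunLike.congr_fun hφ g
  rw [hW, hφ', hφ'] at hφw
  refine ⟨φ (X 0), ⟨?_, ?_⟩, ?_, ?_⟩ <;> intro h <;> exact hφw (by simp [W, h])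

end FreeProduct

section TopologicallyFree

open scoped commutatorElement

variable {G : Type u} [Group G] {S : Type v} [MetricSpace S] [MulAction G S]
  [IsIsometricSMul G S] [HyperbolicSpace S]

/-- If two distinct boundary points have small neighbourhoods, an isometry `x` maps one of them off
one of them: otherwise there would be one point in each of the four intersections, and the cross
ratio of these points would be large as seen from `o`, but small as seen from `x⁻¹ • o`. -/
theorem exists_forall_notMem_basicNhd (o : S) {a b : GromovBoundary S} (hab : a ≠ b) :
    ∃ r : ℝ, ∀ x : G, ∃ p ∈ ({a, b} : Set (GromovBoundary S)),
      ∃ q ∈ ({a, b} : Set (GromovBoundary S)), ∀ ζ : GromovBoundary S,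
        Bordification.bdry ζ ∈ basicNhd o p r → Bordification.bdry (x • ζ) ∉ basicNhd o q r := by
  obtain ⟨R, hR⟩ := exists_notMem_basicNhd o hab
  have h0 := hypConst_nonneg (S := S)
  obtain ⟨u, hu⟩ := exists_represents (Bordification.bdry a)
  obtain ⟨v, hv⟩ := exists_represents (Bordification.bdry b)
  have huv := eventually_lt_of_notMem_basicNhd hu hv hR (s := R + 2 * hypConst S + 1)
    (by linarith)
  set C := R + 4 * hypConst S + 1 with hC
  set r := |C| + hypConst S + 1 with hr
  have hrC : C < r - hypConst S := by linarith [le_abs_self C]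
  -- points near the same endpoint have a large product, points near different ones a small one
  have hlarge : ∀ {p s t : S}, r < gromovProduct o p s → r < gromovProduct o p t →
      r - hypConst S ≤ gromovProduct o s t := fun h1 h2 =>
    sub_hypConst_le ((gromovProduct_comm _ _ _).trans_gt h1 |>.le) h2.le
  have hsmall : ∀ {i : ℕ} {s t : S}, gromovProduct o (u i) (v i) < R + 2 * hypConst S + 1 →
      r < gromovProduct o (u i) s → r < gromovProduct o (v i) t → gromovProduct o s t ≤ C := by
    intro i s t h1 h2 h3
    have h4 := gromovProduct_le_of_lt (z := t) h1.le
      (by rw [gromovProduct_comm o t]; linarith)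
    rw [gromovProduct_comm] at h4 ⊢
    have h5 := gromovProduct_le_of_lt (z := s) h4
      (by rw [gromovProduct_comm o s]; linarith)
    linarith
  refine ⟨r, fun x => ?_⟩
  by_contra! hc
  obtain ⟨ζ₁, h1, h1'⟩ := hc a (Set.mem_insert _ _) a (Set.mem_insert _ _)
  obtain ⟨ζ₂, h2, h2'⟩ := hc a (Set.mem_insert _ _) b (Set.mem_insert_of_mem _ rfl)
  obtain ⟨ζ₃, h3, h3'⟩ := hc b (Set.mem_insert_of_mem _ rfl) a (Set.mem_insert _ _)
  obtain ⟨ζ₄, h4, h4'⟩ := hc b (Set.mem_insert_of_mem _ rfl) b (Set.mem_insert_of_mem _ rfl)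
  obtain ⟨z₁, e1⟩ := exists_represents (Bordification.bdry ζ₁)
  obtain ⟨z₂, e2⟩ := exists_represents (Bordification.bdry ζ₂)
  obtain ⟨z₃, e3⟩ := exists_represents (Bordification.bdry ζ₃)
  obtain ⟨z₄, e4⟩ := exists_represents (Bordification.bdry ζ₄)
  obtain ⟨i, hi, k1, k2, k3, k4, k1', k2', k3', k4'⟩ := (huv.and
    ((eventually_of_mem_basicNhd h1 hu e1).and ((eventually_of_mem_basicNhd h2 hu e2).and
    ((eventually_of_mem_basicNhd h3 hv e3).and ((eventually_of_mem_basicNhd h4 hv e4).and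
    ((eventually_of_mem_basicNhd h1' hu (e1.smul x)).and
    ((eventually_of_mem_basicNhd h2' hv (e2.smul x)).and
    ((eventually_of_mem_basicNhd h3' hu (e3.smul x)).and
    (eventually_of_mem_basicNhd h4' hv (e4.smul x)))))))))).exists
  have l1 := hlarge k1 k2
  have l2 := hlarge k3 k4
  have l3 := hsmall hi k1 k3
  have l4 := hsmall hi k2 k4
  have l1' := hlarge k1' k3'
  have l2' := hlarge k2' k4'
  have l3' := hsmall hi k1' k2'
  have l4' := hsmall hi k3' k4'
  have hcr := gromovProduct_cross_ratio o (x⁻¹ • o) (z₁ i) (z₂ i) (z₃ i) (z₄ i)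
  have hx : ∀ s t : S, gromovProduct (x⁻¹ • o) s t = gromovProduct o (x • s) (x • t) :=
    fun s t => by rw [← gromovProduct_smul x, smul_inv_smul]
  simp only [hx] at hcr
  linarith

/-- Elements whose supports in the limit set are contained in disjoint sets commute. -/
theorem commutator_eq_one_of_disjoint (hell : ellipticRadical G S = ⊥) {s t x : G}
    {A B : Set (GromovBoundary S)} (hs : ∀ ζ ∈ limitSet G S, ζ ∉ A → s • ζ = ζ)
    (ht : ∀ ζ ∈ limitSet G S, ζ ∉ B → t • ζ = ζ) (hx : ∀ ζ ∈ A, x • ζ ∉ B) :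
    ⁅x * s * x⁻¹, t⁆ = 1 := by
  have hd : Equiv.Perm.Disjoint (MulAction.toPermHom G (limitSet G S) (x * s * x⁻¹))
      (MulAction.toPermHom G (limitSet G S) t) := fun ζ => by
    by_cases h : ζ.1 ∈ B
    · have h1 : x⁻¹ • ζ.1 ∉ A := fun hA => hx _ hA (by rwa [smul_inv_smul])
      refine Or.inl (Subtype.ext ?_)
      have h2 := hs _ ((limitSet G S).smul_mem x⁻¹ ζ.2) h1
      change (x * s * x⁻¹) • ζ.1 = ζ.1
      rw [mul_smul, mul_smul, h2, smul_inv_smul]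
    · exact Or.inr (Subtype.ext (ht ζ.1 ζ.2 h))
  have h1 : MulAction.toPermHom G (limitSet G S) ⁅x * s * x⁻¹, t⁆ = 1 := by
    rw [map_commutatorElement]
    exact commutatorElement_eq_one_iff_commute.2 hd.commute
  rw [← Subgroup.mem_bot, ← hell, ellipticRadical, mem_fixingSubgroup_iff]
  intro ζ hζ
  exact congrArg Subtype.val (Equiv.Perm.congr_fun h1 ⟨ζ, hζ⟩)

/-- If `g` fixes the limit points in an open set, its conjugates by powers of an element `f` with
both endpoints in that set are supported near either endpoint of `f`. Any conjugate of one of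
these two elements commutes with one of them, which is a mixed identity. -/
theorem isTopologicallyFree_of_isMixedIdentityFree (hmif : IsMixedIdentityFree G)
    (hgen : IsGeneralType G S) (hell : ellipticRadical G S = ⊥) :
    IsTopologicallyFree G (limitSet G S) := by
  intro g hg
  by_contra hne
  obtain ⟨ξ, hξ⟩ := Set.nonempty_iff_ne_empty.2 hne
  obtain ⟨V, hV, hξV, hVg⟩ : ∃ V : Set (GromovBoundary S), IsOpen V ∧ ξ.1 ∈ V ∧
      ∀ ζ ∈ limitSet G S, ζ ∈ V → g • ζ = ζ := by
    obtain ⟨V, hV, hVi⟩ := isOpen_induced_iff.1 (isOpen_interior (s :=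
      MulAction.fixedBy (limitSet G S) g))
    refine ⟨V, hV, (hVi ▸ hξ : ξ ∈ Subtype.val ⁻¹' V), fun ζ hζ hζV => ?_⟩
    have h1 : (⟨ζ, hζ⟩ : limitSet G S) ∈ Subtype.val ⁻¹' V := hζV
    rw [hVi] at h1
    have h2 : (⟨ζ, hζ⟩ : limitSet G S) ∈ MulAction.fixedBy (limitSet G S) g :=
      interior_subset h1
    exact congrArg Subtype.val (MulAction.mem_fixedBy.1 h2)
  obtain ⟨f, a, b, hf, ha, hb, -, -⟩ := hgen.exists_isAxial_mem ξ.2 (hV.mem_nhds hξV) ∅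
  obtain ⟨z, -⟩ := exists_represents (Bordification.bdry a)
  set o := z 0
  obtain ⟨Ra, -, hRa⟩ := (boundary_hasBasis_nhds o a).mem_iff.1 (hV.mem_nhds ha)
  obtain ⟨Rb, -, hRb⟩ := (boundary_hasBasis_nhds o b).mem_iff.1 (hV.mem_nhds hb)
  obtain ⟨r, hr⟩ := exists_forall_notMem_basicNhd (G := G) o hf.1
  obtain ⟨n, hn, hn'⟩ := ((hf.inv.eventually_mem o r Rb).and
    (hf.eventually_mem o r Ra)).exists
  have hsa : ∀ ζ ∈ limitSet G S, ζ ∉ {c | Bordification.bdry c ∈ basicNhd o a r} →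
      (f ^ n * g * (f ^ n)⁻¹) • ζ = ζ := fun ζ hζ hζa => by
    have h1 := hRb (hn ζ hζa)
    rw [inv_pow] at h1
    rw [mul_smul, mul_smul, hVg _ ((limitSet G S).smul_mem _ hζ) h1, smul_inv_smul]
  have hsb : ∀ ζ ∈ limitSet G S, ζ ∉ {c | Bordification.bdry c ∈ basicNhd o b r} →
      ((f ^ n)⁻¹ * g * f ^ n) • ζ = ζ := fun ζ hζ hζb => by
    have h1 := hRa (hn' ζ hζb)
    rw [mul_smul, mul_smul, hVg _ ((limitSet G S).smul_mem _ hζ) h1, inv_smul_smul]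
  obtain ⟨x, ⟨haa, hab⟩, hba, hbb⟩ := hmif.exists_forall_commutator_ne
    (a := f ^ n * g * (f ^ n)⁻¹) (b := (f ^ n)⁻¹ * g * f ^ n)
    (by rwa [Ne, conj_eq_one_iff])
    (fun h => hg ((conj_eq_one_iff (a := (f ^ n)⁻¹)).1 (by rwa [inv_inv])))
  obtain ⟨p, rfl | rfl, q, rfl | rfl, hpq⟩ := hr x
  · exact haa (commutator_eq_one_of_disjoint hell hsa hsa hpq)
  · exact hab (commutator_eq_one_of_disjoint hell hsa hsb hpq)
  · exact hba (commutator_eq_one_of_disjoint hell hsb hsa hpq)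
  · exact hbb (commutator_eq_one_of_disjoint hell hsb hsb hpq)

end TopologicallyFree

end HypGroup

theorem mainTheorem1 (G : Type u) [Group G]
    (hG : HypGroup.IsFaithfulWeaklyHyperbolic.{u, v} G) :
    List.TFAE [
      HypGroup.IsLimFree.{u, v} G,
      ∀ (S : Type v) [MetricSpace S] [HypGroup.HyperbolicSpace S] [MulAction G S]
        [IsIsometricSMul G S], HypGroup.IsGeneralType G S →
          HypGroup.ellipticRadical G S = ⊥ →
            HypGroup.IsTopologicallyFree G (HypGroup.limitSet G S),
      HypGroup.IsMixedIdentityFree G] := by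
  tfae_have 1 → 3 := by
    rintro ⟨S, _, _, _, _, hgen, hfree⟩
    exact HypGroup.isMixedIdentityFree_of_isTopologicallyFree hgen hfree
  tfae_have 3 → 2 := fun h S _ _ _ _ hgen hell =>
    HypGroup.isTopologicallyFree_of_isMixedIdentityFree h hgen hell
  tfae_have 2 → 1 := by
    intro h
    obtain ⟨S, _, _, _, _, hgen, hfaith⟩ := hG
    refine ⟨S, _, inferInstance, _, inferInstance, hgen, h S hgen ?_⟩
    rw [eq_bot_iff]
    intro g hg
    rw [HypGroup.ellipticRadical, mem_fixingSubgroup_iff] at hg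
    refine Subgroup.mem_bot.2 (hfaith.eq_of_smul_eq_smul fun ζ => ?_)
    rw [one_smul]
    exact Subtype.ext (hg ζ.1 ζ.2)
  tfae_finish
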